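/- Let $\pi$ be a (possibly empty) set of primes, and let $\mathbb{Z}[1/\pi]=\{m/n : m\in\mathbb{Z},\ n \text{ a non-zero integer all of whose prime divisors lie in }\pi\}\subseteq\mathbb{Q}$; a $\pi$-unit is a unit of this ring. Let $N$ be a torsion-free nilpotent group of finite (Prüfer) rank that is $\pi$-divisible (every element has a $p$-th root in $N$ for each $p\in\pi$). Let $\sigma$ be a $\pi$-like endomorphism of $N$, that is, an injective endomorphism such that the characteristic polynomial of the automorphism it induces on the rational Lie algebra of $N$ (the Lie algebra $\log R$ of the Mal'cev completion $R$ of $N$) has all its coefficients in $\mathbb{Z}[1/\pi]$. Then $\sigma(Z(N))\leqslant Z(N)$, and if the determinant $\det(\sigma|_{Z(N)})$ (computed on $\mathbb{Q}\otimes_{\mathbb{Z}} Z(N)$) is a $\pi$-unit, then $\sigma$ is an automorphism of $N$. In particular (the case $\pi=\emptyset$): if $N$ is torsion-free nilpotent of finite rank and $\sigma$ is an injective endomorphism whose induced automorphism of the rational Lie algebra has characteristic polynomial in $\mathbb{Z}[X]$, and $\det(\sigma|_{Z(N)})=\pm1$, then $\sigma$ is an automorphism of $N$. -/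

import Mathlib

open scoped TensorProduct

/-! ### The ring `ℤ[1/π]` -/

/-- An integer is a `π`-number if all its prime divisors lie in `π`. -/
def IsPiNumber (π : Set ℕ) (n : ℤ) : Prop :=
  ∀ p : ℕ, p.Prime → (p : ℤ) ∣ n → p ∈ π

theorem IsPiNumber.mul {π : Set ℕ} {m n : ℤ} (hm : IsPiNumber π m) (hn : IsPiNumber π n) :
    IsPiNumber π (m * n) := fun p hp h =>
  ((Nat.prime_iff_prime_int.mp hp).dvd_or_dvd h).elim (hm p hp) (hn p hp)

theorem IsPiNumber.one (π : Set ℕ) : IsPiNumber π 1 := fun p hp h =>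
  absurd (Int.natCast_dvd_natCast.mp (by simpa using h) : p ∣ 1) hp.not_dvd_one

/-- The subring `ℤ[1/π] = {m / n : m ∈ ℤ, n a non-zero π-number}` of `ℚ`. -/
def PiInt (π : Set ℕ) : Subring ℚ where
  carrier := {q | ∃ m n : ℤ, n ≠ 0 ∧ IsPiNumber π n ∧ q = m / n}
  zero_mem' := ⟨0, 1, one_ne_zero, IsPiNumber.one π, by simp⟩
  one_mem' := ⟨1, 1, one_ne_zero, IsPiNumber.one π, by simp⟩
  add_mem' := by
    rintro _ _ ⟨m, n, hn, hπ, rfl⟩ ⟨m', n', hn', hπ', rfl⟩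
    have h : (n : ℚ) ≠ 0 := by exact_mod_cast hn
    have h' : (n' : ℚ) ≠ 0 := by exact_mod_cast hn'
    exact ⟨m * n' + n * m', n * n', mul_ne_zero hn hn', hπ.mul hπ', by
      push_cast; exact div_add_div _ _ h h'⟩
  mul_mem' := by
    rintro _ _ ⟨m, n, hn, hπ, rfl⟩ ⟨m', n', hn', hπ', rfl⟩
    exact ⟨m * m', n * n', mul_ne_zero hn hn', hπ.mul hπ', by
      push_cast; exact div_mul_div_comm _ _ _ _⟩
  neg_mem' := by
    rintro _ ⟨m, n, hn, hπ, rfl⟩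
    exact ⟨-m, n, hn, hπ, by push_cast; ring⟩

/-- A `π`-unit is (a rational number that is) a unit of the ring `ℤ[1/π]`. -/
def IsPiUnit (π : Set ℕ) (q : ℚ) : Prop :=
  ∃ u : (PiInt π)ˣ, ((u : PiInt π) : ℚ) = q

/-! ### Groups -/

/-- A group is `π`-divisible if every element has a `p`-th root for every `p ∈ π`. -/
def IsPiDivisible (π : Set ℕ) (N : Type*) [Group N] : Prop :=
  ∀ p ∈ π, ∀ x : N, ∃ y : N, y ^ p = x

/-- Finite (Prüfer) rank: for some `r`, every finitely generated subgroup can be generated by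
at most `r` elements. -/
class HasFiniteRank (N : Type*) [Group N] : Prop where
  exists_bound : ∃ r : ℕ, ∀ H : Subgroup N, H.FG →
    ∃ T : Finset N, T.card ≤ r ∧ Subgroup.closure (T : Set N) = H

/-- The values of a homomorphism from a group of finite rank to a rational vector space span a
finite-dimensional subspace. -/
theorem HasFiniteRank.finite_span_range {N : Type*} [Group N] [HasFiniteRank N]
    {V : Type*} [AddCommGroup V] [Module ℚ V] (f : N →* Multiplicative V) :
    (Submodule.span ℚ (Set.range fun x => (f x).toAdd)).FG := by
  classical
  obtain ⟨r, hr⟩ := HasFiniteRank.exists_bound (N := N)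
  obtain ⟨b, hb, hspan, hli⟩ := exists_linearIndependent ℚ (Set.range fun x => (f x).toAdd)
  rw [← hspan]
  refine Submodule.fg_span ?_
  by_contra hinf
  obtain ⟨t, htb, hcard⟩ := Set.Infinite.exists_subset_card_eq hinf (r + 1)
  choose! g hg using fun x (hx : x ∈ b) => hb hx
  obtain ⟨T, hT, hcl⟩ := hr (Subgroup.closure ((t.image g : Finset N) : Set N)) ⟨_, rfl⟩
  let W : Submodule ℚ V := Submodule.span ℚ ((T.image fun x => (f x).toAdd : Finset V) : Set V)
  have hW : ∀ x ∈ Subgroup.closure (T : Set N), (f x).toAdd ∈ W := by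
    intro x hx
    induction hx using Subgroup.closure_induction with
    | mem x hx => exact Submodule.subset_span (by simpa using ⟨x, hx, rfl⟩)
    | one => simp
    | mul x y _ _ hx hy => simpa using W.add_mem hx hy
    | inv x _ hx => simpa using W.neg_mem hx
  have htW : (t : Set V) ⊆ W := by
    intro v hv
    have h1 := hW (g v) (by
      rw [hcl]; exact Subgroup.subset_closure (by simpa using ⟨v, hv, rfl⟩))
    rwa [show (f (g v)).toAdd = v from hg v (htb hv)] at h1
  have hlit : LinearIndependent ℚ (fun x : (t : Set V) => (x : V)) :=
    hli.comp (Set.inclusion htb) (Set.inclusion_injective htb)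
  have h2 : t.card ≤ (T.image fun x => (f x).toAdd).card := by
    have h3 := linearIndependent_le_span' _ hlit
      ((T.image fun x => (f x).toAdd : Finset V) : Set V) (by rw [Subtype.range_coe]; exact htW)
    simpa using h3
  have h4 := Finset.card_image_le (s := T) (f := fun x => (f x).toAdd)
  omega

/-! ### The rational Mal'cev Lie algebra

Let `N` be a torsion-free nilpotent group of class `c`, and `I` the augmentation ideal of `ℚ[N]`.
The natural map from `N` to the group `1 + I / I ^ (c + 1)` of unipotent units of
`ℚ[N] / I ^ (c + 1)` is injective, and the elements of this group having a non-zero power in the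
image of `N` form the Mal'cev completion `R` of `N`. The rational Lie algebra of `N` is `log R`,
which is the Lie subalgebra generated by `log N` in `ℚ[N] / I ^ (c + 1)` with its commutator
bracket. -/

section MalcevLie

attribute [local instance] LieRing.ofAssociativeRing

variable (N : Type*) [Group N]

/-- The augmentation `ℚ[N] → ℚ`, sending every group element to `1`. -/
noncomputable def augmentationMap : MonoidAlgebra ℚ N →ₐ[ℚ] ℚ :=
  MonoidAlgebra.lift ℚ ℚ N 1

/-- The augmentation ideal of `ℚ[N]`. -/
noncomputable def augmentationIdeal : Ideal (MonoidAlgebra ℚ N) :=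
  RingHom.ker (augmentationMap N)

instance : (augmentationIdeal N).IsTwoSided :=
  inferInstanceAs (RingHom.ker (augmentationMap N)).IsTwoSided

/-- The truncated group algebra `ℚ[N] / I ^ (c + 1)`, with `c` the nilpotency class of `N`. -/
abbrev TruncGroupAlgebra : Type _ :=
  MonoidAlgebra ℚ N ⧸ augmentationIdeal N ^ (Group.nilpotencyClass N + 1)

/-- The natural homomorphism from `N` to the multiplicative monoid of `ℚ[N] / I ^ (c + 1)`. -/
noncomputable def toTruncGroupAlgebra : N →* TruncGroupAlgebra N :=
  (Ideal.Quotient.mk (augmentationIdeal N ^ (Group.nilpotencyClass N + 1)) :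
    MonoidAlgebra ℚ N →* TruncGroupAlgebra N).comp (MonoidAlgebra.of ℚ N)

/-- The logarithm `∑_{k ≥ 1} (-1) ^ (k + 1) (x - 1) ^ k / k` of the image of `x ∈ N` in
`ℚ[N] / I ^ (c + 1)`; the terms with `k > c` vanish. -/
noncomputable def malcevLog (x : N) : TruncGroupAlgebra N :=
  ∑ k ∈ Finset.Icc 1 (Group.nilpotencyClass N),
    ((-1 : ℚ) ^ (k + 1) / (k : ℚ)) • (toTruncGroupAlgebra N x - 1) ^ k

/-- The rational Lie algebra of `N`. -/
noncomputable def malcevLieAlgebra : LieSubalgebra ℚ (TruncGroupAlgebra N) :=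
  LieSubalgebra.lieSpan ℚ (TruncGroupAlgebra N) (Set.range (malcevLog N))

variable {N}

theorem map_augmentationIdeal_pow_le (σ : N →* N) (n : ℕ) :
    augmentationIdeal N ^ n ≤
      (augmentationIdeal N ^ n).comap (MonoidAlgebra.mapDomainAlgHom ℚ ℚ σ) := by
  have h1 : augmentationIdeal N ≤
      (augmentationIdeal N).comap (MonoidAlgebra.mapDomainAlgHom ℚ ℚ σ) := by
    intro x hx
    have h : (augmentationMap N).comp (MonoidAlgebra.mapDomainAlgHom ℚ ℚ σ) =
        augmentationMap N := by
      ext; simp [augmentationMap]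
    have hx' : augmentationMap N x = 0 := hx
    change augmentationMap N (MonoidAlgebra.mapDomainAlgHom ℚ ℚ σ x) = 0
    rw [← hx']; exact DFunLike.congr_fun h x
  induction n with
  | zero => rw [Submodule.pow_zero, Ideal.one_eq_top]; exact fun _ _ => trivial
  | succ n ih =>
    rw [Submodule.pow_succ]
    refine Ideal.mul_le.mpr fun a ha b hb => ?_
    rw [Ideal.mem_comap, map_mul]
    exact Ideal.mul_mem_mul (ih ha) (h1 hb)

/-- The algebra endomorphism of `ℚ[N] / I ^ (c + 1)` induced by an endomorphism of `N`. -/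
noncomputable def truncMap (σ : N →* N) : TruncGroupAlgebra N →ₐ[ℚ] TruncGroupAlgebra N :=
  Ideal.quotientMapₐ _ (MonoidAlgebra.mapDomainAlgHom ℚ ℚ σ) (map_augmentationIdeal_pow_le σ _)

theorem truncMap_toTruncGroupAlgebra (σ : N →* N) (x : N) :
    truncMap σ (toTruncGroupAlgebra N x) = toTruncGroupAlgebra N (σ x) := by
  simp [truncMap, toTruncGroupAlgebra]

theorem truncMap_malcevLog (σ : N →* N) (x : N) :
    truncMap σ (malcevLog N x) = malcevLog N (σ x) := by
  simp [malcevLog, truncMap_toTruncGroupAlgebra]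

theorem truncMap_mem (σ : N →* N) {a : TruncGroupAlgebra N} (ha : a ∈ malcevLieAlgebra N) :
    truncMap σ a ∈ malcevLieAlgebra N := by
  have h : (malcevLieAlgebra N).map (truncMap σ).toLieHom ≤ malcevLieAlgebra N := by
    rw [malcevLieAlgebra, LieSubalgebra.map_lieSpan, LieSubalgebra.lieSpan_le]
    rintro _ ⟨_, ⟨x, rfl⟩, rfl⟩
    exact LieSubalgebra.subset_lieSpan ⟨σ x, (truncMap_malcevLog σ x).symm⟩
  exact h ⟨a, ha, rfl⟩

/-- The endomorphism of the rational Lie algebra of `N` induced by an endomorphism `σ` of `N`;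
it sends `log x` to `log (σ x)`. -/
noncomputable def malcevLieMap (σ : N →* N) : malcevLieAlgebra N →ₗ⁅ℚ⁆ malcevLieAlgebra N where
  toFun a := ⟨truncMap σ a, truncMap_mem σ a.2⟩
  map_add' a b := Subtype.ext (by simp)
  map_smul' t a := Subtype.ext (by simp)
  map_lie' {a b} := Subtype.ext (by simp [LieRing.of_associative_ring_bracket])

/-- Every element of the augmentation ideal is a rational combination of the `x - 1`, `x ∈ N`. -/
theorem augmentationIdeal_le_span :
    (augmentationIdeal N).restrictScalars ℚ ≤
      Submodule.span ℚ (Set.range fun x : N => MonoidAlgebra.of ℚ N x - 1) := by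
  have key : ∀ a : MonoidAlgebra ℚ N, a - algebraMap ℚ _ (augmentationMap N a) ∈
      Submodule.span ℚ (Set.range fun x : N => MonoidAlgebra.of ℚ N x - 1) := by
    intro a
    induction a using MonoidAlgebra.induction_on with
    | of x =>
      refine Submodule.subset_span ⟨x, ?_⟩
      simp [augmentationMap, MonoidAlgebra.one_def]
    | add a b ha hb =>
      have := Submodule.add_mem _ ha hb
      rwa [show a + b - algebraMap ℚ _ (augmentationMap N (a + b)) =
        (a - algebraMap ℚ _ (augmentationMap N a)) +
          (b - algebraMap ℚ _ (augmentationMap N b)) by rw [map_add, map_add]; abel]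
    | smul r a ha =>
      have := Submodule.smul_mem _ r ha
      rwa [show r • a - algebraMap ℚ _ (augmentationMap N (r • a)) =
        r • (a - algebraMap ℚ _ (augmentationMap N a)) by
          rw [map_smul, smul_sub, smul_eq_mul, map_mul, Algebra.smul_def r (algebraMap _ _ _)]]
  intro a ha
  have ha' : augmentationMap N a = 0 := ha
  simpa [ha'] using key a

theorem of_sub_one_mem (x : N) : MonoidAlgebra.of ℚ N x - 1 ∈ augmentationIdeal N := by
  change augmentationMap N _ = 0
  simp [augmentationMap]

theorem exists_fg_augmentationIdeal_le [HasFiniteRank N] :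
    ∃ F : Submodule ℚ (MonoidAlgebra ℚ N), F.FG ∧
      F ≤ (augmentationIdeal N).restrictScalars ℚ ∧
      (augmentationIdeal N).restrictScalars ℚ ≤
        F ⊔ (augmentationIdeal N ^ 2).restrictScalars ℚ := by
  classical
  let J := (augmentationIdeal N ^ 2).restrictScalars ℚ
  let f : N →* Multiplicative (MonoidAlgebra ℚ N ⧸ J) := MonoidHom.mk'
    (fun x => Multiplicative.ofAdd (J.mkQ (MonoidAlgebra.of ℚ N x - 1))) (by
      intro x y
      rw [← ofAdd_add, ← map_add]
      congr 1
      refine (Submodule.Quotient.eq J).mpr ?_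
      change _ ∈ augmentationIdeal N ^ 2
      have h := Ideal.mul_mem_mul (of_sub_one_mem x) (of_sub_one_mem y)
      rw [Submodule.pow_succ, Submodule.pow_one]
      convert h using 1
      rw [map_mul]; noncomm_ring)
  obtain ⟨s, hs, hspan⟩ := Submodule.fg_span_iff_fg_span_finset_subset _ |>.mp
    (HasFiniteRank.finite_span_range f)
  choose! g hg using fun v (hv : v ∈ s) => hs hv
  refine ⟨Submodule.span ℚ ((s.image fun v => MonoidAlgebra.of ℚ N (g v) - 1 : Finset _) : Set _),
    ⟨_, rfl⟩, ?_, ?_⟩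
  · rw [Submodule.span_le]
    intro a ha
    obtain ⟨v, -, rfl⟩ := by simpa using ha
    exact of_sub_one_mem (g v)
  · refine augmentationIdeal_le_span.trans ?_
    rw [Submodule.span_le]
    rintro _ ⟨x, rfl⟩
    have h1 : J.mkQ (MonoidAlgebra.of ℚ N x - 1) ∈ Submodule.span ℚ (s : Set _) := by
      rw [← hspan]; exact Submodule.subset_span ⟨x, rfl⟩
    have h2 : Submodule.span ℚ (s : Set _) ≤ (Submodule.span ℚ
        ((s.image fun v => MonoidAlgebra.of ℚ N (g v) - 1 : Finset _) : Set _)).map J.mkQ := by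
      rw [Submodule.span_le]
      intro v hv
      exact ⟨_, Submodule.subset_span (Finset.mem_coe.mpr (Finset.mem_image_of_mem _ hv)), hg v hv⟩
    obtain ⟨b, hb, hbx⟩ := h2 h1
    have h3 : MonoidAlgebra.of ℚ N x - 1 - b ∈ J := (Submodule.Quotient.eq J).mp hbx.symm
    have := Submodule.add_mem_sup hb h3
    simpa using this

theorem exists_fg_sup_augmentationIdeal_pow [HasFiniteRank N] (n : ℕ) :
    ∃ F : Submodule ℚ (MonoidAlgebra ℚ N), F.FG ∧
      F ⊔ (augmentationIdeal N ^ n).restrictScalars ℚ = ⊤ := by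
  obtain ⟨F, hF, hFI, hIF⟩ := exists_fg_augmentationIdeal_le (N := N)
  have hG : ∀ n : ℕ, ∃ G : Submodule ℚ (MonoidAlgebra ℚ N), G.FG ∧
      G ≤ (augmentationIdeal N ^ (n + 1)).restrictScalars ℚ ∧
      (augmentationIdeal N ^ (n + 1)).restrictScalars ℚ ≤
        G ⊔ (augmentationIdeal N ^ (n + 2)).restrictScalars ℚ := by
    intro n
    induction n with
    | zero => exact ⟨F, hF, by simpa [Submodule.pow_one] using hFI,
        by simpa [Submodule.pow_one] using hIF⟩
    | succ n ih =>
      obtain ⟨G, hGfg, hGI, hIG⟩ := ih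
      refine ⟨G * F, hGfg.mul hF, ?_, ?_⟩
      · rw [Submodule.mul_le]
        intro a ha b hb
        change a * b ∈ augmentationIdeal N ^ (n + 1 + 1)
        rw [Submodule.pow_succ]
        exact Ideal.mul_mem_mul (hGI ha) (hFI hb)
      · intro x hx
        have hx' : x ∈ augmentationIdeal N ^ (n + 1) * augmentationIdeal N := by
          rw [← Submodule.pow_succ]; exact hx
        refine Submodule.mul_induction_on hx' ?_ fun a b ha hb => Submodule.add_mem _ ha hb
        intro a ha b hb
        obtain ⟨g, hg, a', ha', rfl⟩ := Submodule.mem_sup.mp (hIG ha)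
        obtain ⟨f, hf, b', hb', rfl⟩ := Submodule.mem_sup.mp (hIF hb)
        have e : (g + a') * (f + b') = g * f + (g * b' + a' * (f + b')) := by noncomm_ring
        rw [e]
        refine Submodule.add_mem_sup (Submodule.mul_mem_mul hg hf) (Submodule.add_mem _ ?_ ?_)
        · change g * b' ∈ augmentationIdeal N ^ (n + 1 + 2)
          rw [Ideal.IsTwoSided.pow_add]
          exact Ideal.mul_mem_mul (hGI hg) hb'
        · change a' * (f + b') ∈ augmentationIdeal N ^ (n + 2 + 1)
          rw [Submodule.pow_succ]
          exact Ideal.mul_mem_mul ha' hb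
  induction n with
  | zero => exact ⟨⊥, Submodule.fg_bot, by
      rw [Submodule.pow_zero, Ideal.one_eq_top, Submodule.restrictScalars_top, sup_top_eq]⟩
  | succ n ih =>
    obtain ⟨E, hE, hEI⟩ := ih
    cases n with
    | zero =>
      refine ⟨Submodule.span ℚ {1}, Submodule.fg_span_singleton 1, eq_top_iff.mpr fun a _ => ?_⟩
      rw [zero_add, Submodule.pow_one]
      have h : a - algebraMap ℚ _ (augmentationMap N a) ∈
          (augmentationIdeal N).restrictScalars ℚ := by
        change augmentationMap N _ = 0
        rw [map_sub, AlgHom.commutes]; simp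
      have h1 : algebraMap ℚ _ (augmentationMap N a) ∈
          Submodule.span ℚ {(1 : MonoidAlgebra ℚ N)} := by
        rw [Algebra.algebraMap_eq_smul_one]
        exact Submodule.smul_mem _ _ (Submodule.mem_span_singleton_self _)
      simpa using Submodule.add_mem_sup h1 h
    | succ n =>
      obtain ⟨G, hGfg, -, hIG⟩ := hG n
      refine ⟨E ⊔ G, hE.sup hGfg, eq_top_iff.mpr ?_⟩
      rw [← hEI, sup_assoc]
      exact sup_le_sup_left hIG E

instance [HasFiniteRank N] : FiniteDimensional ℚ (TruncGroupAlgebra N) := by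
  obtain ⟨F, hF, h⟩ :=
    exists_fg_sup_augmentationIdeal_pow (N := N) (Group.nilpotencyClass N + 1)
  let q := (Ideal.Quotient.mkₐ ℚ (augmentationIdeal N ^ (Group.nilpotencyClass N + 1))).toLinearMap
  refine ⟨?_⟩
  have h2 : F.map q = ⊤ := by
    refine eq_top_iff.mpr fun y _ => ?_
    obtain ⟨x, rfl⟩ := Ideal.Quotient.mk_surjective y
    have hx : x ∈ F ⊔ (augmentationIdeal N ^
        (Group.nilpotencyClass N + 1)).restrictScalars ℚ := h ▸ Submodule.mem_top
    obtain ⟨f, hf, z, hz, rfl⟩ := Submodule.mem_sup.mp hx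
    refine ⟨f, hf, (Ideal.Quotient.eq.mpr ?_)⟩
    rw [sub_add_cancel_left]
    exact neg_mem hz
  rw [← h2]
  exact hF.map q

instance [HasFiniteRank N] : FiniteDimensional ℚ (malcevLieAlgebra N) :=
  FiniteDimensional.finiteDimensional_submodule (malcevLieAlgebra N).toSubmodule

/-! ### `π`-like maps -/

/-- An endomorphism of a finite-dimensional rational vector space is `π`-like if the coefficients
of its characteristic polynomial lie in `ℤ[1/π]`. -/
def IsPiLike (π : Set ℕ) {V : Type*} [AddCommGroup V] [Module ℚ V] [FiniteDimensional ℚ V]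
    (ν : Module.End ℚ V) : Prop :=
  ∀ i : ℕ, ν.charpoly.coeff i ∈ PiInt π

/-- An endomorphism `σ` of `N` is `π`-like if it is injective and the map it induces on the
rational Lie algebra of `N` is `π`-like. -/
def IsPiLikeEnd [HasFiniteRank N] (π : Set ℕ) (σ : N →* N) : Prop :=
  Function.Injective σ ∧ IsPiLike π (malcevLieMap σ).toLinearMap

/-- The restriction to the centre of an endomorphism preserving the centre. -/
def centerRestrict (σ : N →* N) (h : ∀ z ∈ Subgroup.center N, σ z ∈ Subgroup.center N) :
    Subgroup.center N →* Subgroup.center N :=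
  (σ.comp (Subgroup.center N).subtype).codRestrict (Subgroup.center N) fun z => h z z.2

end MalcevLie

/-- The determinant of an endomorphism `τ` of an abelian group `A` of finite rank: the determinant
of the rational linear map `ℚ ⊗ τ` on `ℚ ⊗ A`. -/
noncomputable def rationalDet {A : Type*} [CommGroup A] (τ : A →* A) : ℚ :=
  LinearMap.det (τ.toAdditive.toIntLinearMap.baseChange ℚ)

open scoped IsMulCommutative in
/-- The determinant of the restriction of `σ` to the centre `Z(N)`. -/
noncomputable def centerDet {N : Type*} [Group N] (σ : N →* N)
    (h : ∀ z ∈ Subgroup.center N, σ z ∈ Subgroup.center N) : ℚ :=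
  rationalDet (centerRestrict σ h)

/-!
Write `R = ℤ[1/π]`, and let `γ_k` and `Z_k` denote the terms of the lower and the upper central
series of `N`. The Mal'cev correspondence is not needed: everything is read off from homomorphisms
to `ℚ`, on which `σ` acts by composition. An action is *integral* if it satisfies a monic polynomial
over `R`, and has an *integral inverse* if it satisfies a polynomial over `R` with constant
coefficient `1`.

*The centre is invariant.* As `σ` is injective and `N` has finite rank, every element of `N` has a
power in `σ(N)` (`NoTorsion.exists_pow_mem_range`). In a torsion-free nilpotent group an element
that commutes with a power of `y` commutes with `y`, so `σ` maps the centre to itself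
(`NoTorsion.map_mem_center`).

*Integrality.* A homomorphism `h : N → ℚ` extends to a linear form on `ℚ[N] / I ^ (c + 1)` sending
`log x` to `h x`; hence the `π`-like condition makes `σ` integral on the abelianization of `N`
(`IsPiLike.exists_monic_aeval_compOp`). Each `γ_k / γ_(k + 1)` is a quotient of a tensor power of
the abelianization, so `σ` is integral on it, and consequently on the centre
(`exists_monic_aeval_compOp_subgroup`). As `R` is integrally closed, the characteristic polynomial
of `σ` on `ℚ ⊗ Z_1` has coefficients in `R`, and if its determinant is a unit, then `σ` has an
integral inverse on `Z_1` (`exists_coeff_zero_eq_one_of_isPiUnit`).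

*Ascent.* The commutator embeds `Z_2 / Z_1` in `Hom(N, Z_1)`. There `σ⁻¹` becomes
`b ↦ σ⁻¹ ∘ b ∘ σ`, a product of two commuting integral operators: composition with the inverse on
`Z_1`, and composition with `σ` on the abelianization of `N`. So `σ` has an integral inverse on
`Z_2 / Z_1` (`exists_coeff_zero_eq_one_quotient_center`), and the hypotheses pass from `N` to
`N / Z_1`. On a torsion-free `π`-divisible abelian group, an `R`-module, an endomorphism with an
integral inverse is bijective (`bijective_of_aeval_compOp_eq_zero`). Induction on the class then
shows that `σ` is bijective (`bijective_of_integral_inverse_center`).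
-/

open Polynomial
open scoped commutatorElement

/-! ### Polynomial relations between commuting elements -/

section Relations

variable {R : Type*} [CommRing R]

/-- The product of two elements that are integral modulo an ideal is integral modulo it. -/
theorem exists_monic_aeval_mul_mem_span {C : Type*} [CommRing C] [Algebra R C] (s t : C)
    {f g : R[X]} (hf : f.Monic) (hg : g.Monic) :
    ∃ h : R[X], h.Monic ∧ aeval (s * t) h ∈ Ideal.span {aeval s f, aeval t g} := by
  set I : Ideal C := Ideal.span {aeval s f, aeval t g}
  let q : C →ₐ[R] C ⧸ I := Ideal.Quotient.mkₐ R I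
  have hs : IsIntegral R (q s) := ⟨f, hf, by
    rw [← aeval_def, aeval_algHom_apply]
    exact Ideal.Quotient.eq_zero_iff_mem.mpr (Ideal.subset_span (by simp))⟩
  have ht : IsIntegral R (q t) := ⟨g, hg, by
    rw [← aeval_def, aeval_algHom_apply]
    exact Ideal.Quotient.eq_zero_iff_mem.mpr (Ideal.subset_span (by simp))⟩
  obtain ⟨h, hh, h0⟩ := hs.mul ht
  refine ⟨h, hh, Ideal.Quotient.eq_zero_iff_mem.mp ?_⟩
  rwa [← map_mul, ← aeval_def, aeval_algHom_apply] at h0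

/-- If, modulo an ideal, `t` is integral and `s * t` has an integral inverse, then `s` has an
integral inverse, namely `t * (s * t)⁻¹`. A relation with constant coefficient `1` for an element `y` is the same as
a monic relation for `y⁻¹`. -/
theorem exists_coeff_zero_eq_one_aeval_mem_span {C : Type*} [CommRing C] [Algebra R C] (s t : C)
    {g G : R[X]} (hg : g.Monic) (hG : G.coeff 0 = 1) :
    ∃ H : R[X], H.coeff 0 = 1 ∧ aeval s H ∈ Ideal.span {aeval t g, aeval (s * t) G} := by
  set I : Ideal C := Ideal.span {aeval t g, aeval (s * t) G}
  let q : C →ₐ[R] C ⧸ I := Ideal.Quotient.mkₐ R I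
  have ht : IsIntegral R (q t) := ⟨g, hg, by
    rw [← aeval_def, aeval_algHom_apply]
    exact Ideal.Quotient.eq_zero_iff_mem.mpr (Ideal.subset_span (by simp))⟩
  have h0 : aeval (q (s * t)) G = 0 := by
    rw [aeval_algHom_apply]
    exact Ideal.Quotient.eq_zero_iff_mem.mpr (Ideal.subset_span (by simp))
  -- the inverse `w` of `s * t` modulo the ideal, read off from the relation `G`
  set w : C ⧸ I := -aeval (q (s * t)) G.divX with hw
  have hinv : w * q (s * t) = 1 := by
    rw [← divX_mul_X_add G, hG] at h0
    simp only [map_add, map_mul, aeval_X, map_one] at h0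
    rw [hw, neg_mul, map_mul]
    linear_combination -h0
  have hrev : ∀ (F : R[X]) (x y : C ⧸ I), y * x = 1 → aeval x F = 0 → aeval y F.reverse = 0 := by
    intro F x y hxy hF
    let _ : Invertible x := ⟨y, hxy, by rw [mul_comm, hxy]⟩
    exact (eval₂_reverse_eq_zero_iff (algebraMap R (C ⧸ I)) x F).mpr hF
  have hmonic : G.reverse.Monic := by
    nontriviality R
    rw [Monic, reverse_leadingCoeff, trailingCoeff,
      natTrailingDegree_eq_zero.mpr (Or.inr (by rw [hG]; exact one_ne_zero)), hG]
  have hwint : IsIntegral R w := ⟨G.reverse, hmonic, hrev _ _ _ hinv h0⟩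
  obtain ⟨F, hF, hF0⟩ := ht.mul hwint
  refine ⟨F.reverse, by rw [coeff_zero_reverse, hF.leadingCoeff], ?_⟩
  refine Ideal.Quotient.eq_zero_iff_mem.mp ?_
  have := hrev F (q t * w) (q s) (by rw [← mul_assoc, ← map_mul, mul_comm, hinv]) hF0
  rwa [aeval_algHom_apply] at this

open scoped IsMulCommutative in
theorem Commute.exists_monic_aeval_mul {E : Type*} [Ring E] [Algebra R E] {s t : E}
    (hst : Commute s t) {f g : R[X]} (hf : f.Monic) (hg : g.Monic) :
    ∃ h : R[X], h.Monic ∧ ∃ a b : E, aeval (s * t) h = a * aeval s f + b * aeval t g := by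
  have hc : IsMulCommutative (Algebra.adjoin R {s, t}) := by
    refine Algebra.isMulCommutative_adjoin R ?_
    rintro x (rfl | rfl) y (rfl | rfl)
    exacts [rfl, hst, hst.symm, rfl]
  obtain ⟨h, hh, hmem⟩ := exists_monic_aeval_mul_mem_span (R := R)
    (⟨s, Algebra.subset_adjoin (by simp)⟩ : Algebra.adjoin R {s, t})
    ⟨t, Algebra.subset_adjoin (by simp)⟩ hf hg
  obtain ⟨a, b, hab⟩ := Ideal.mem_span_pair.mp hmem
  refine ⟨h, hh, a, b, ?_⟩
  have := congrArg (Algebra.adjoin R {s, t}).val hab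
  simp only [map_add, map_mul, ← aeval_algHom_apply] at this
  exact this.symm

open scoped IsMulCommutative in
theorem Commute.exists_coeff_zero_eq_one_aeval {E : Type*} [Ring E] [Algebra R E] {s t : E}
    (hst : Commute s t) {g G : R[X]} (hg : g.Monic) (hG : G.coeff 0 = 1) :
    ∃ H : R[X], H.coeff 0 = 1 ∧
      ∃ a b : E, aeval s H = a * aeval t g + b * aeval (s * t) G := by
  have hc : IsMulCommutative (Algebra.adjoin R {s, t}) := by
    refine Algebra.isMulCommutative_adjoin R ?_
    rintro x (rfl | rfl) y (rfl | rfl)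
    exacts [rfl, hst, hst.symm, rfl]
  obtain ⟨H, hH, hmem⟩ := exists_coeff_zero_eq_one_aeval_mem_span (R := R)
    (⟨s, Algebra.subset_adjoin (by simp)⟩ : Algebra.adjoin R {s, t})
    ⟨t, Algebra.subset_adjoin (by simp)⟩ hg hG
  obtain ⟨a, b, hab⟩ := Ideal.mem_span_pair.mp hmem
  refine ⟨H, hH, a, b, ?_⟩
  have := congrArg (Algebra.adjoin R {s, t}).val hab
  simp only [map_add, map_mul, ← aeval_algHom_apply] at this
  exact this.symm

end Relations

/-! ### Characteristic polynomials over `ℤ[1/π]` -/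

/-- If `f(A) = 0` then `X - A` divides `f(X)` in the matrices over `K[X]`; take determinants. -/
theorem Matrix.charpoly_dvd_pow {K : Type*} [CommRing K] {n : Type*} [Fintype n] [DecidableEq n]
    (A : Matrix n n K) (f : K[X]) (hf : aeval A f = 0) : A.charpoly ∣ f ^ Fintype.card n := by
  let c : Matrix n n K →+* Matrix n n K[X] := (C : K →+* K[X]).mapMatrix
  have hcomm : Commute (Matrix.scalar n (X : K[X])) (c A) :=
    Matrix.scalar_commute _ (fun r => Commute.all _ _) _
  have h1 : Matrix.scalar n (X : K[X]) - c A ∣ Matrix.scalar n f - c (aeval A f) := by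
    have e : Matrix.scalar n f - c (aeval A f) =
        f.sum fun i a => Matrix.scalar n (C a) * (Matrix.scalar n (X : K[X]) ^ i - c A ^ i) := by
      have e1 : Matrix.scalar n f =
          f.sum fun i a => Matrix.scalar n (C a) * Matrix.scalar n (X : K[X]) ^ i := by
        conv_lhs => rw [← f.sum_C_mul_X_pow_eq]
        simp only [Polynomial.sum, map_sum, map_mul, map_pow]
      have e2 : c (aeval A f) = f.sum fun i a => Matrix.scalar n (C a) * c A ^ i := by
        rw [aeval_eq_sum_range' (Nat.lt_succ_self _),
          Polynomial.sum_over_range' _ (by simp) _ (Nat.lt_succ_self _), map_sum]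
        refine Finset.sum_congr rfl fun i _ => ?_
        rw [Algebra.smul_def, map_mul, map_pow]
        congr 1
        ext i j
        simp [c, Matrix.algebraMap_eq_diagonal, Matrix.diagonal_apply, apply_ite]
      rw [e1, e2]
      simp only [Polynomial.sum, mul_sub, Finset.sum_sub_distrib]
    rw [e]
    refine Finset.dvd_sum fun i _ => ?_
    obtain ⟨d, hd⟩ := hcomm.sub_dvd_pow_sub_pow i
    refine ⟨Matrix.scalar n (C (f.coeff i)) * d, ?_⟩
    beta_reduce
    rw [hd, ← mul_assoc, ← mul_assoc]
    congr 1
    exact (Matrix.scalar_commute _ (fun r => Commute.all _ _) _).eq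
  rw [hf, map_zero, sub_zero] at h1
  obtain ⟨d, hd⟩ := h1
  refine ⟨d.det, ?_⟩
  have := congrArg Matrix.det hd
  rw [Matrix.det_mul] at this
  simpa [Matrix.charpoly, Matrix.charmatrix, c] using this

theorem LinearMap.charpoly_dvd_pow {K V : Type*} [Field K] [AddCommGroup V] [Module K V]
    [FiniteDimensional K V] (ν : Module.End K V) (f : K[X]) (hf : aeval ν f = 0) :
    ν.charpoly ∣ f ^ Module.finrank K V := by
  let b := Module.finBasis K V
  have := Matrix.charpoly_dvd_pow (LinearMap.toMatrixAlgEquiv b ν) f (by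
    rw [← AlgEquiv.coe_toAlgHom, aeval_algHom_apply, hf, map_zero])
  rw [Fintype.card_fin] at this
  rwa [← LinearMap.charpoly_toMatrix ν b]

/-- The non-zero `π`-numbers, as a submonoid of `ℤ`. -/
def piNumberSubmonoid (π : Set ℕ) : Submonoid ℤ where
  carrier := {n | n ≠ 0 ∧ IsPiNumber π n}
  one_mem' := ⟨one_ne_zero, IsPiNumber.one π⟩
  mul_mem' h h' := ⟨mul_ne_zero h.1 h'.1, h.2.mul h'.2⟩

theorem inv_mem_piInt {π : Set ℕ} {n : ℤ} (h0 : n ≠ 0) (hn : IsPiNumber π n) :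
    (n : ℚ)⁻¹ ∈ PiInt π := ⟨1, n, h0, hn, by simp⟩

instance (π : Set ℕ) : IsLocalization (piNumberSubmonoid π) (PiInt π) where
  map_units := by
    rintro ⟨n, h0, hn⟩
    have h : (n : ℚ) ≠ 0 := by exact_mod_cast h0
    refine IsUnit.of_mul_eq_one ⟨_, inv_mem_piInt h0 hn⟩ (Subtype.ext ?_)
    simp [h]
  surj := by
    rintro ⟨_, m, n, h0, hn, rfl⟩
    have h : (n : ℚ) ≠ 0 := by exact_mod_cast h0
    exact ⟨(m, ⟨n, h0, hn⟩), Subtype.ext (by simp [h])⟩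
  exists_of_eq := by
    intro a b hab
    have := congrArg Subtype.val hab
    exact ⟨1, by simpa using this⟩

instance (π : Set ℕ) : IsIntegrallyClosed (PiInt π) :=
  isIntegrallyClosed_of_isLocalization (R := ℤ) (M := piNumberSubmonoid π) (PiInt π)
    (fun _ hn => mem_nonZeroDivisors_of_ne_zero hn.1)

instance (π : Set ℕ) : IsFractionRing (PiInt π) ℚ :=
  IsFractionRing.isFractionRing_of_isDomain_of_isLocalization (piNumberSubmonoid π) (PiInt π) ℚ

theorem IsPiLike.exists_lift {π : Set ℕ} {V : Type*} [AddCommGroup V] [Module ℚ V]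
    [FiniteDimensional ℚ V] {ν : Module.End ℚ V} (h : IsPiLike π ν) :
    ∃ f : (PiInt π)[X], f.Monic ∧ f.map (algebraMap (PiInt π) ℚ) = ν.charpoly := by
  have h1 : ν.charpoly ∈ lifts (algebraMap (PiInt π) ℚ) := by
    rw [lifts_iff_coeff_lifts]
    exact fun i => ⟨⟨_, h i⟩, rfl⟩
  obtain ⟨f, hf, -, hm⟩ := lifts_and_degree_eq_and_monic h1 ν.charpoly_monic
  exact ⟨f, hm, hf⟩

/-- Gauss's lemma: `ℤ[1/π]` is integrally closed, and the characteristic polynomial divides a power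
of `f`. -/
theorem isPiLike_of_aeval_eq_zero {π : Set ℕ} {V : Type*} [AddCommGroup V] [Module ℚ V]
    [FiniteDimensional ℚ V] {ν : Module.End ℚ V} {f : (PiInt π)[X]} (hf : f.Monic)
    (h : aeval ν f = 0) : IsPiLike π ν := by
  intro i
  have h1 := ν.charpoly_dvd_pow (f.map (algebraMap (PiInt π) ℚ)) (by rwa [aeval_map_algebraMap])
  rw [← Polynomial.map_pow] at h1
  have h2 := isIntegral_coeff_of_dvd _ _ (hf.pow _) ν.charpoly_monic h1 i
  obtain ⟨r, hr⟩ := IsIntegrallyClosed.isIntegral_iff.mp h2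
  rw [← hr]
  exact r.2

/-! ### Homomorphisms to the rationals -/

/-- Homomorphisms from a group to the additive group of `ℚ`, as plain functions. -/
def IsRatHom {G : Type*} [Group G] (h : G → ℚ) : Prop :=
  ∀ x y, h (x * y) = h x + h y

namespace IsRatHom

variable {G H : Type*} [Group G] [Group H] {h : G → ℚ}

theorem map_one (hh : IsRatHom h) : h 1 = 0 := by simpa using hh 1 1

theorem map_inv (hh : IsRatHom h) (x : G) : h x⁻¹ = -h x := by
  have := hh x x⁻¹
  rw [mul_inv_cancel, hh.map_one] at this
  linarith

theorem map_pow (hh : IsRatHom h) (x : G) (n : ℕ) : h (x ^ n) = n * h x := by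
  induction n with
  | zero => simp [hh.map_one]
  | succ n ih => rw [pow_succ, hh, ih]; push_cast; ring

theorem map_zpow (hh : IsRatHom h) (x : G) (n : ℤ) : h (x ^ n) = n * h x := by
  cases n with
  | ofNat n => simpa using hh.map_pow x n
  | negSucc n => rw [zpow_negSucc, hh.map_inv, hh.map_pow, Int.cast_negSucc]; ring

theorem comp (hh : IsRatHom h) (φ : H →* G) : IsRatHom fun x => h (φ x) := fun x y => by
  beta_reduce
  rw [_root_.map_mul, hh]

/-- As `ℚ` is an injective abelian group, a homomorphism `h` to `ℚ` extends along a homomorphism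
`j` to an abelian group whose kernel it kills. -/
theorem exists_extension {A : Type*} [AddCommGroup A] (hh : IsRatHom h) (j : G → A)
    (hj : ∀ x y, j (x * y) = j x + j y) (hker : ∀ x, j x = 0 → h x = 0) :
    ∃ k : A →+ ℚ, ∀ x, k (j x) = h x := by
  have hj1 : j 1 = 0 := by simpa using hj 1 1
  have hjinv : ∀ x, j x⁻¹ = -j x := fun x => by
    rw [eq_neg_iff_add_eq_zero, ← hj, inv_mul_cancel, hj1]
  have hwd : ∀ x y, j x = j y → h x = h y := fun x y e => by
    have := hker (x * y⁻¹) (by rw [hj, hjinv, e, add_neg_cancel])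
    rw [hh, hh.map_inv] at this
    linarith
  let W : AddSubgroup A :=
    { carrier := Set.range j
      zero_mem' := ⟨1, hj1⟩
      add_mem' := by rintro _ _ ⟨x, rfl⟩ ⟨y, rfl⟩; exact ⟨x * y, hj x y⟩
      neg_mem' := by rintro _ ⟨x, rfl⟩; exact ⟨x⁻¹, hjinv x⟩ }
  let g : W →+ ℚ := AddMonoidHom.mk' (fun w => h w.2.choose) fun v w => by
    rw [← hh]
    refine hwd _ _ ?_
    rw [hj, (v + w).2.choose_spec, v.2.choose_spec, w.2.choose_spec]
    rfl
  obtain ⟨k, hk⟩ := (Module.Baer.of_divisible ℚ).extension_property_addMonoidHom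
    W.subtype W.subtype_injective g
  refine ⟨k, fun x => ?_⟩
  have := DFunLike.congr_fun hk ⟨j x, x, rfl⟩
  refine Eq.trans this (hwd _ _ ?_)
  exact (⟨j x, x, rfl⟩ : W).2.choose_spec

end IsRatHom

/-- A group is torsion-free if its only element of finite order is `1`. -/
def NoTorsion (G : Type*) [Group G] : Prop := ∀ (x : G) (n : ℕ), 0 < n → x ^ n = 1 → x = 1

theorem noTorsion_iff {G : Type*} [Group G] :
    NoTorsion G ↔ ∀ x : G, IsOfFinOrder x → x = 1 := by
  simp only [NoTorsion, isOfFinOrder_iff_pow_eq_one]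
  exact ⟨fun h x ⟨n, hn, hx⟩ => h x n hn hx, fun h x n hn hx => h x ⟨n, hn, hx⟩⟩

theorem NoTorsion.subgroup {G : Type*} [Group G] (hG : NoTorsion G) (H : Subgroup G) :
    NoTorsion H := fun x n hn hx =>
  Subtype.ext (hG x n hn (by simpa using congrArg Subtype.val hx))

/-- Homomorphisms to `ℚ` separate the elements of a torsion-free abelian group. -/
theorem NoTorsion.exists_isRatHom_ne_zero {A : Type*} [CommGroup A] (hA : NoTorsion A) {a : A}
    (ha : a ≠ 1) : ∃ h : A → ℚ, IsRatHom h ∧ h a ≠ 0 := by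
  have hone : IsRatHom fun n : Multiplicative ℤ => (n.toAdd : ℚ) := fun m n => by simp
  obtain ⟨k, hk⟩ := hone.exists_extension (A := Additive A)
    (fun n => n.toAdd • Additive.ofMul a) (fun m n => by rw [toAdd_mul, add_zsmul]) (by
      intro n hn
      rw [← ofMul_zpow, ofMul_eq_zero] at hn
      have h1 : a ^ n.toAdd.natAbs = 1 := by rwa [pow_natAbs_eq_one]
      by_contra h0
      exact ha (hA a _ (Int.natAbs_pos.mpr fun e => h0 (by simp [e])) h1))
  refine ⟨fun x => k (Additive.ofMul x), fun x y => by simp, ?_⟩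
  have := hk (Multiplicative.ofAdd 1)
  simp only [toAdd_ofAdd, one_zsmul] at this
  beta_reduce
  rw [this]
  simp

theorem NoTorsion.eq_of_forall_isRatHom {A : Type*} [CommGroup A] (hA : NoTorsion A) {a b : A}
    (hab : ∀ h : A → ℚ, IsRatHom h → h a = h b) : a = b := by
  by_contra hne
  obtain ⟨h, hh, h0⟩ := hA.exists_isRatHom_ne_zero (a := a * b⁻¹) (by rwa [Ne, mul_inv_eq_one])
  rw [hh, hh.map_inv, hab h hh] at h0
  simp at h0

/-! ### Torsion-free nilpotent groups -/

section Nilpotent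

open Subgroup

variable {G : Type*} [Group G]

theorem commutatorElement_pow_left {u y : G} (h : ⁅u, y⁆ ∈ center G) (n : ℕ) :
    ⁅u ^ n, y⁆ = ⁅u, y⁆ ^ n := by
  induction n with
  | zero => simp
  | succ n ih =>
    rw [pow_succ, commutatorElement_mul_left_eq_conj_mul, ih, mem_center_iff.mp h,
      mul_inv_cancel_right, ← pow_succ']

theorem commutatorElement_pow_right {u y : G} (h : ⁅u, y⁆ ∈ center G) (n : ℕ) :
    ⁅u, y ^ n⁆ = ⁅u, y⁆ ^ n := by
  have h' : ⁅y, u⁆ ∈ center G := by rw [← commutatorElement_inv]; exact inv_mem h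
  rw [← commutatorElement_inv, commutatorElement_pow_left h', ← inv_pow, commutatorElement_inv]

theorem mem_center_iff_commutatorElement {x : G} : x ∈ center G ↔ ∀ y : G, ⁅x, y⁆ = 1 := by
  simp only [mem_center_iff, commutatorElement_eq_one_iff_mul_comm, eq_comm (a := x * _)]

theorem mk_mem_center_quotient_iff {x : G} :
    (x : G ⧸ center G) ∈ center (G ⧸ center G) ↔ ∀ y : G, ⁅x, y⁆ ∈ center G := by
  rw [mem_center_iff_commutatorElement]
  constructor
  · intro h y
    rw [← QuotientGroup.eq_one_iff]
    exact h y
  · intro h y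
    induction y using QuotientGroup.induction_on with
    | H y => exact (QuotientGroup.eq_one_iff _).mpr (h y)

theorem NoTorsion.center_quotient_center (h : NoTorsion (center G)) :
    NoTorsion (center (G ⧸ center G)) := by
  rintro ⟨x, hx⟩ n hn hxn
  induction x using QuotientGroup.induction_on with
  | H x =>
    have hx' := mk_mem_center_quotient_iff.mp hx
    have hxn' : x ^ n ∈ center G := by
      rw [← QuotientGroup.eq_one_iff]
      simpa using congrArg Subtype.val hxn
    refine Subtype.ext ((QuotientGroup.eq_one_iff x).mpr ?_)
    rw [mem_center_iff_commutatorElement] at hxn' ⊢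
    intro y
    have h1 := h ⟨_, hx' y⟩ n hn (Subtype.ext (by
      simpa [commutatorElement_pow_left (hx' y)] using hxn' y))
    exact congrArg Subtype.val h1

/-- Commutation with the elements of `G` embeds each upper central factor in a power of the
preceding one, so torsion in `G` would give torsion in the centre. -/
theorem noTorsion_of_center [Group.IsNilpotent G] : NoTorsion (center G) → NoTorsion G := by
  refine Group.nilpotent_center_quotient_ind
    (P := fun G _ _ => NoTorsion (center G) → NoTorsion G) G ?_ ?_
  · intro G _ _ _ x _ _ _
    exact Subsingleton.elim _ _
  · intro G _ _ ih h x n hn hx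
    have h1 := ih h.center_quotient_center x n hn (by rw [← QuotientGroup.mk_pow, hx]; rfl)
    have h2 : x ∈ center G := (QuotientGroup.eq_one_iff x).mp h1
    exact congrArg Subtype.val (h ⟨x, h2⟩ n hn (Subtype.ext hx))

theorem NoTorsion.quotient_center [Group.IsNilpotent G] (h : NoTorsion G) :
    NoTorsion (G ⧸ center G) :=
  noTorsion_of_center (h.subgroup _).center_quotient_center

theorem NoTorsion.mem_center_of_pow_mem [Group.IsNilpotent G] (h : NoTorsion G) {x : G} {n : ℕ}
    (hn : 0 < n) (hx : x ^ n ∈ center G) : x ∈ center G :=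
  (QuotientGroup.eq_one_iff x).mp
    (h.quotient_center x n hn (by
      rw [← QuotientGroup.mk_pow]; exact (QuotientGroup.eq_one_iff _).mpr hx))

theorem NoTorsion.commute_of_commute_pow [Group.IsNilpotent G] :
    NoTorsion G → ∀ (x y : G) (n : ℕ), 0 < n → Commute x (y ^ n) → Commute x y := by
  refine Group.nilpotent_center_quotient_ind
    (P := fun G _ _ => NoTorsion G →
      ∀ (x y : G) (n : ℕ), 0 < n → Commute x (y ^ n) → Commute x y) G ?_ ?_
  · intro G _ _ _ x y _ _ _
    exact Subsingleton.elim _ _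
  · intro G _ _ ih h x y n hn hxy
    have h1 := ih h.quotient_center x y n hn (by
      rw [← QuotientGroup.mk_pow]; exact hxy.map (QuotientGroup.mk' (center G)))
    have h2 : ⁅x, y⁆ ∈ center G := by
      rw [← QuotientGroup.eq_one_iff]
      exact commutatorElement_eq_one_iff_commute.mpr h1
    rw [← commutatorElement_eq_one_iff_commute] at hxy ⊢
    exact h _ n hn (by rw [← commutatorElement_pow_right h2, hxy])

/-- An endomorphism of a torsion-free nilpotent group preserves the centre as soon as every element
has a non-trivial power in its image. -/
theorem NoTorsion.map_mem_center [Group.IsNilpotent G] (h : NoTorsion G) {σ : G →* G}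
    (hσ : ∀ y, ∃ n : ℕ, 0 < n ∧ ∃ x, σ x = y ^ n) {z : G} (hz : z ∈ center G) :
    σ z ∈ center G := by
  rw [mem_center_iff]
  intro y
  obtain ⟨n, hn, x, hx⟩ := hσ y
  refine (h.commute_of_commute_pow _ y n hn ?_).symm
  rw [← hx]
  exact Commute.map ((mem_center_iff.mp hz x).symm : Commute z x) σ

end Nilpotent

/-! ### Finite rank -/

section FiniteRank

variable {G : Type*} [Group G]

theorem HasFiniteRank.subgroup [HasFiniteRank G] (H : Subgroup G) : HasFiniteRank H := by
  classical
  obtain ⟨r, hr⟩ := HasFiniteRank.exists_bound (N := G)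
  refine ⟨r, fun K ⟨S, hS⟩ => ?_⟩
  obtain ⟨T, hT, hcl⟩ := hr (K.map H.subtype)
    ⟨S.image H.subtype, by rw [Finset.coe_image, ← MonoidHom.map_closure, hS]⟩
  have hTH : ∀ x ∈ T, x ∈ H := fun x hx => by
    have : x ∈ K.map H.subtype := by rw [← hcl]; exact Subgroup.subset_closure hx
    obtain ⟨y, -, rfl⟩ := this
    exact y.2
  refine ⟨T.subtype (· ∈ H), ?_, ?_⟩
  · rw [Finset.card_subtype]
    exact (Finset.card_filter_le _ _).trans hT
  · refine Subgroup.map_injective H.subtype_injective ?_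
    rw [MonoidHom.map_closure, ← hcl]
    congr 1
    ext x
    simp only [Set.mem_image, Finset.mem_coe, Finset.mem_subtype, Subgroup.coe_subtype,
      Subtype.exists, exists_and_left, exists_prop, exists_eq_right_right]
    exact ⟨fun h => h.1, fun h => ⟨h, hTH x h⟩⟩

theorem HasFiniteRank.of_surjective {Q : Type*} [Group Q] [HasFiniteRank G] (φ : G →* Q)
    (hφ : Function.Surjective φ) : HasFiniteRank Q := by
  classical
  obtain ⟨r, hr⟩ := HasFiniteRank.exists_bound (N := G)
  refine ⟨r, fun K hK => ?_⟩
  obtain ⟨S, rfl⟩ := hK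
  choose s hs using hφ
  obtain ⟨T, hT, hcl⟩ := hr (Subgroup.closure ((S.image s : Finset G) : Set G)) ⟨_, rfl⟩
  refine ⟨T.image φ, Finset.card_image_le.trans hT, ?_⟩
  rw [Finset.coe_image, ← MonoidHom.map_closure, hcl, MonoidHom.map_closure, Finset.coe_image,
    Set.image_image]
  simp [hs]

end FiniteRank

section Abelian

variable {A : Type*} [CommGroup A]

theorem IsRatHom.exists_tensor_lift {h : A → ℚ} (hh : IsRatHom h) :
    ∃ φ : ℚ ⊗[ℤ] Additive A →ₗ[ℚ] ℚ, ∀ a, φ (1 ⊗ₜ Additive.ofMul a) = h a := by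
  let g : Additive A →+ ℚ := AddMonoidHom.mk' (fun a => h a.toMul) fun a b => by
    rw [toMul_add, hh]
  exact ⟨g.toIntLinearMap.liftBaseChange ℚ, fun a => by simp [g]⟩

theorem isRatHom_tmul (φ : ℚ ⊗[ℤ] Additive A →ₗ[ℚ] ℚ) :
    IsRatHom fun a : A => φ (1 ⊗ₜ Additive.ofMul a) := fun a b => by
  beta_reduce
  rw [ofMul_mul, TensorProduct.tmul_add, map_add]

theorem span_one_tmul_eq_top :
    Submodule.span ℚ (Set.range fun a : A => (1 : ℚ) ⊗ₜ[ℤ] Additive.ofMul a) = ⊤ := by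
  refine eq_top_iff.mpr fun t _ => ?_
  induction t using TensorProduct.induction_on with
  | zero => exact zero_mem _
  | tmul q a =>
    have : q ⊗ₜ[ℤ] a = q • ((1 : ℚ) ⊗ₜ[ℤ] Additive.ofMul a.toMul) := by
      simp [TensorProduct.smul_tmul']
    rw [this]
    exact Submodule.smul_mem _ _ (Submodule.subset_span ⟨_, rfl⟩)
  | add s t hs ht => exact add_mem (hs trivial) (ht trivial)

instance [HasFiniteRank A] : FiniteDimensional ℚ (ℚ ⊗[ℤ] Additive A) := by
  let f : A →* Multiplicative (ℚ ⊗[ℤ] Additive A) := MonoidHom.mk'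
    (fun a => Multiplicative.ofAdd ((1 : ℚ) ⊗ₜ[ℤ] Additive.ofMul a)) fun a b => by
      rw [ofMul_mul, TensorProduct.tmul_add, ofAdd_add]
  exact ⟨(span_one_tmul_eq_top (A := A)) ▸ HasFiniteRank.finite_span_range f⟩

/-- The rational extension of an injective endomorphism is injective, hence surjective as `ℚ ⊗ A`
is finite-dimensional. -/
theorem exists_pow_mem_range_of_comm [HasFiniteRank A] (hA : NoTorsion A) (τ : A →* A)
    (hτ : Function.Injective τ) (a : A) : ∃ n : ℕ, 0 < n ∧ ∃ b, τ b = a ^ n := by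
  let ν : Module.End ℚ (ℚ ⊗[ℤ] Additive A) := τ.toAdditive.toIntLinearMap.baseChange ℚ
  have hinj : Function.Injective ν :=
    Module.Flat.lTensor_preserves_injective_linearMap (M := ℚ) τ.toAdditive.toIntLinearMap hτ
  obtain ⟨t, ht⟩ := LinearMap.injective_iff_surjective.mp hinj (1 ⊗ₜ Additive.ofMul a)
  have hden : ∃ n : ℕ, 0 < n ∧ ∃ b : A, (n : ℚ) • t = 1 ⊗ₜ Additive.ofMul b := by
    clear ht
    induction t using TensorProduct.induction_on with
    | zero => exact ⟨1, one_pos, 1, by simp⟩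
    | tmul q x =>
      refine ⟨q.den, q.den_pos, x.toMul ^ q.num, ?_⟩
      rw [TensorProduct.smul_tmul', ofMul_zpow, ofMul_toMul, TensorProduct.tmul_smul,
        TensorProduct.smul_tmul', smul_eq_mul, Rat.den_mul_eq_num]
      simp
    | add s t hs ht =>
      obtain ⟨m, hm, b, hb⟩ := hs
      obtain ⟨n, hn, c, hc⟩ := ht
      refine ⟨m * n, Nat.mul_pos hm hn, b ^ n * c ^ m, ?_⟩
      rw [ofMul_mul, ofMul_pow, ofMul_pow, TensorProduct.tmul_add, TensorProduct.tmul_smul,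
        TensorProduct.tmul_smul, ← hb, ← hc]
      simp only [← Nat.cast_smul_eq_nsmul ℚ, smul_smul, smul_add]
      push_cast
      rw [mul_comm (n : ℚ)]
  obtain ⟨n, hn, b, hb⟩ := hden
  refine ⟨n, hn, b, hA.eq_of_forall_isRatHom fun h hh => ?_⟩
  obtain ⟨φ, hφ⟩ := hh.exists_tensor_lift
  rw [hh.map_pow, ← hφ, ← hφ, ← ht, ← smul_eq_mul, ← map_smul, ← map_smul, hb]
  simp [ν]

end Abelian

/-! ### The image of an injective endomorphism -/

section Image

open Subgroup

/-- An injective endomorphism of a torsion-free nilpotent group of finite rank has an image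
containing a non-trivial power of every element. The induction passes to the quotient by the
isolator of the last non-trivial term of the lower central series, which is central and invariant
under every endomorphism. -/
theorem exists_pow_mem_range_of_lowerCentralSeries (c : ℕ) : ∀ {G : Type*} [Group G]
    [Group.IsNilpotent G] [HasFiniteRank G] (_ : (⊤ : Subgroup G).lowerCentralSeries c = ⊥)
    (_ : NoTorsion G) (σ : G →* G) (_ : Function.Injective σ) (y : G),
    ∃ n : ℕ, 0 < n ∧ ∃ x, σ x = y ^ n := by
  induction c with
  | zero =>
    intro G _ _ _ hc _ σ _ y
    have : y = 1 := by rw [← mem_bot, ← hc]; exact mem_top y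
    exact ⟨1, one_pos, 1, by simp [this]⟩
  | succ c ih =>
    intro G _ _ _ hc hG σ hσ y
    have hcen : (⊤ : Subgroup G).lowerCentralSeries c ≤ center G := fun x hx => by
      rw [mem_center_iff_commutatorElement]
      intro y
      rw [← mem_bot, ← hc, Subgroup.lowerCentralSeries_succ]
      exact commutator_mem_commutator hx (mem_top y)
    have hcen' : ∀ x : G, (∃ n : ℕ, 0 < n ∧ x ^ n ∈ (⊤ : Subgroup G).lowerCentralSeries c) →
        x ∈ center G := fun x ⟨n, hn, hx⟩ => hG.mem_center_of_pow_mem hn (hcen hx)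
    let A : Subgroup G :=
      { carrier := {x | ∃ n : ℕ, 0 < n ∧ x ^ n ∈ (⊤ : Subgroup G).lowerCentralSeries c}
        one_mem' := ⟨1, one_pos, by simp⟩
        mul_mem' := by
          rintro x z hx ⟨n, hn, hz⟩
          have hxc : Commute x z := (mem_center_iff.mp (hcen' x hx) z).symm
          obtain ⟨m, hm, hx⟩ := hx
          refine ⟨m * n, Nat.mul_pos hm hn, ?_⟩
          rw [hxc.mul_pow, pow_mul, mul_comm, pow_mul]
          exact mul_mem (pow_mem hx n) (pow_mem hz m)
        inv_mem' := by
          rintro x ⟨n, hn, hx⟩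
          exact ⟨n, hn, by rw [inv_pow]; exact inv_mem hx⟩ }
    have hA : ∀ (x : G) (n : ℕ), 0 < n → x ^ n ∈ A → x ∈ A := by
      rintro x n hn ⟨m, hm, hx⟩
      exact ⟨n * m, Nat.mul_pos hn hm, by rwa [pow_mul]⟩
    have hAσ : ∀ x ∈ A, σ x ∈ A := by
      rintro x ⟨n, hn, hx⟩
      refine ⟨n, hn, ?_⟩
      rw [← map_pow]
      exact lowerCentralSeries_mono c le_top
        (map_lowerCentralSeries ⊤ σ c ▸ mem_map_of_mem σ hx)
    have : A.Normal := ⟨fun x hx g => by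
      rwa [mem_center_iff.mp (hcen' x hx) g, mul_inv_cancel_right]⟩
    let _ : CommGroup A :=
      { mul_comm := fun x z => Subtype.ext (mem_center_iff.mp (hcen' z z.2) x) }
    have : HasFiniteRank A := HasFiniteRank.subgroup A
    have : HasFiniteRank (G ⧸ A) :=
      HasFiniteRank.of_surjective (QuotientGroup.mk' A) (QuotientGroup.mk'_surjective A)
    have hpow : ∀ a ∈ A, ∃ n : ℕ, 0 < n ∧ ∃ b ∈ A, σ b = a ^ n := fun a ha => by
      obtain ⟨n, hn, b, hb⟩ := exists_pow_mem_range_of_comm (hG.subgroup A)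
        ((σ.comp A.subtype).codRestrict A fun a => hAσ a a.2)
        (fun a b hab => Subtype.ext (hσ (congrArg Subtype.val hab))) ⟨a, ha⟩
      exact ⟨n, hn, b, b.2, congrArg Subtype.val hb⟩
    have hq : NoTorsion (G ⧸ A) := fun x n hn hx => by
      induction x using QuotientGroup.induction_on with
      | H x =>
        rw [← QuotientGroup.mk_pow, QuotientGroup.eq_one_iff] at hx
        exact (QuotientGroup.eq_one_iff x).mpr (hA x n hn hx)
    have hqc : (⊤ : Subgroup (G ⧸ A)).lowerCentralSeries c = ⊥ := by
      rw [← map_top_of_surjective _ (QuotientGroup.mk'_surjective A), ← map_lowerCentralSeries,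
        eq_bot_iff, map_le_iff_le_comap]
      intro x hx
      exact (QuotientGroup.eq_one_iff x).mpr ⟨1, one_pos, by simpa using hx⟩
    let σ' : G ⧸ A →* G ⧸ A := QuotientGroup.map A A σ hAσ
    have hσ' : Function.Injective σ' := by
      refine (injective_iff_map_eq_one σ').mpr fun x hx => ?_
      induction x using QuotientGroup.induction_on with
      | H x =>
        obtain ⟨n, hn, b, hb, e⟩ := hpow (σ x) ((QuotientGroup.eq_one_iff (σ x)).mp hx)
        rw [← map_pow] at e
        exact (QuotientGroup.eq_one_iff x).mpr (hA x n hn (hσ e ▸ hb))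
    obtain ⟨n, hn, x, hx⟩ := ih hqc hq σ' hσ' y
    induction x using QuotientGroup.induction_on with
    | H x =>
      have hx' : (σ x)⁻¹ * y ^ n ∈ A := QuotientGroup.eq.mp hx
      obtain ⟨m, hm, b, -, e⟩ := hpow _ hx'
      refine ⟨n * m, Nat.mul_pos hn hm, x ^ m * b, ?_⟩
      have hc : Commute (σ x) ((σ x)⁻¹ * y ^ n) := mem_center_iff.mp (hcen' _ hx') _
      rw [map_mul, map_pow, e, ← hc.mul_pow, mul_inv_cancel_left, pow_mul]

theorem NoTorsion.exists_pow_mem_range {G : Type*} [Group G] [Group.IsNilpotent G]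
    [HasFiniteRank G] (hG : NoTorsion G) {σ : G →* G} (hσ : Function.Injective σ) (y : G) :
    ∃ n : ℕ, 0 < n ∧ ∃ x, σ x = y ^ n := by
  obtain ⟨c, hc⟩ := Subgroup.nilpotent_iff_lowerCentralSeries.mp ‹Group.IsNilpotent G›
  exact exists_pow_mem_range_of_lowerCentralSeries c hc hG σ hσ y

end Image

/-! ### Polynomials in composition operators -/

section CompOp

variable {π : Set ℕ} {X Y : Type*}

/-- Composition with a self-map `s` of `X`, as an operator on the rational functions on `X`. -/
def compOp (s : X → X) : Module.End ℚ (X → ℚ) := LinearMap.funLeft ℚ ℚ s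

theorem compOp_apply (s : X → X) (h : X → ℚ) (x : X) : compOp s h x = h (s x) := rfl

theorem compOp_pow_apply (s : X → X) (i : ℕ) (h : X → ℚ) (x : X) :
    (compOp s ^ i) h x = h (s^[i] x) := by
  induction i generalizing x with
  | zero => rfl
  | succ i ih => rw [pow_succ', Module.End.mul_apply, compOp_apply, ih, Function.iterate_succ_apply]

theorem aeval_compOp_apply (s : X → X) (f : (PiInt π)[X]) (h : X → ℚ) (x : X) :
    aeval (compOp s) f h x = f.sum fun i c => (c : ℚ) * h (s^[i] x) := by
  rw [aeval_def, eval₂_eq_sum, Polynomial.sum, LinearMap.sum_apply, Finset.sum_apply]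
  refine Finset.sum_congr rfl fun i _ => ?_
  beta_reduce
  rw [Module.End.mul_apply, ← compOp_pow_apply s i h x]
  rfl

theorem aeval_compOp_comp {s : X → X} {t : Y → Y} {φ : X → Y} (hφ : ∀ x, φ (s x) = t (φ x))
    (f : (PiInt π)[X]) (k : Y → ℚ) (x : X) :
    aeval (compOp s) f (fun x => k (φ x)) x = aeval (compOp t) f k (φ x) := by
  simp only [aeval_compOp_apply, (Function.Semiconj.iterate_right hφ _).eq]

/-- A linear form restricted to a family of vectors that `ν` maps to itself turns
polynomials in `ν` into polynomials in a composition operator. -/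
theorem apply_aeval_eq_aeval_compOp {V : Type*} [AddCommGroup V] [Module ℚ V]
    (ν : Module.End ℚ V) (φ : V →ₗ[ℚ] ℚ) {s : X → X} {l : X → V} (hl : ∀ x, ν (l x) = l (s x))
    (f : (PiInt π)[X]) (x : X) :
    φ (aeval ν f (l x)) = aeval (compOp s) f (fun x => φ (l x)) x := by
  have hpow : ∀ (i : ℕ) (x : X), (ν ^ i) (l x) = l (s^[i] x) := by
    intro i
    induction i with
    | zero => exact fun _ => rfl
    | succ i ih =>
      intro x
      rw [pow_succ, Module.End.mul_apply, hl, ih, Function.iterate_succ_apply]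
  rw [aeval_compOp_apply, aeval_def, eval₂_eq_sum, Polynomial.sum, LinearMap.sum_apply, map_sum]
  refine Finset.sum_congr rfl fun i _ => ?_
  rw [Module.End.mul_apply, hpow]
  exact map_smul φ ((f.coeff i : PiInt π) : ℚ) _

theorem IsRatHom.aeval_compOp {G : Type*} [Group G] {h : G → ℚ} (hh : IsRatHom h) (σ : G →* G)
    (f : (PiInt π)[X]) : IsRatHom (aeval (compOp σ) f h) := fun x y => by
  simp only [aeval_compOp_apply, Polynomial.sum, ← Finset.sum_add_distrib, iterate_map_mul, hh _ _,
    mul_add]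

end CompOp

/-! ### Homomorphisms to the rationals and the rational Lie algebra -/

section DualNumbers

attribute [local instance] LieRing.ofAssociativeRing

variable {N : Type*} [Group N] {h : N → ℚ}

/-- A homomorphism `h` to `ℚ` gives the homomorphism `x ↦ 1 + h x ε` to the units of the dual
numbers, and so a homomorphism from the group algebra to the dual numbers. -/
noncomputable def IsRatHom.dualNumberHom (hh : IsRatHom h) :
    MonoidAlgebra ℚ N →ₐ[ℚ] DualNumber ℚ :=
  MonoidAlgebra.lift ℚ (DualNumber ℚ) N
    { toFun := fun x => 1 + TrivSqZeroExt.inr (h x)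
      map_one' := by simp [hh.map_one]
      map_mul' := fun x y => by
        rw [hh]
        ext <;> simp [add_comm] }

theorem IsRatHom.dualNumberHom_of (hh : IsRatHom h) (x : N) :
    hh.dualNumberHom (MonoidAlgebra.of ℚ N x) = 1 + TrivSqZeroExt.inr (h x) := by
  simp [dualNumberHom]

theorem IsRatHom.fst_dualNumberHom (hh : IsRatHom h) (a : MonoidAlgebra ℚ N) :
    (hh.dualNumberHom a).fst = augmentationMap N a := by
  have e : (TrivSqZeroExt.fstHom ℚ ℚ ℚ).comp hh.dualNumberHom = augmentationMap N := by
    ext x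
    simp [dualNumberHom, augmentationMap]
  exact DFunLike.congr_fun e a

theorem IsRatHom.dualNumberHom_eq_zero (hh : IsRatHom h) {n : ℕ} (hn : 2 ≤ n)
    {a : MonoidAlgebra ℚ N} (ha : a ∈ augmentationIdeal N ^ n) : hh.dualNumberHom a = 0 := by
  have h2 : augmentationIdeal N ^ 2 ≤ RingHom.ker hh.dualNumberHom := by
    rw [Submodule.pow_succ, Submodule.pow_one]
    refine Ideal.mul_le.mpr fun a ha b hb => ?_
    have ha' : (hh.dualNumberHom a).fst = 0 := (hh.fst_dualNumberHom a).trans ha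
    have hb' : (hh.dualNumberHom b).fst = 0 := (hh.fst_dualNumberHom b).trans hb
    rw [RingHom.mem_ker, map_mul]
    ext <;> simp [ha', hb']
  exact h2 (Ideal.pow_le_pow_right hn ha)

/-- A homomorphism `h` to `ℚ` induces a linear form on `ℚ[N] / I ^ (c + 1)` sending `log x` to
`h x`. -/
theorem IsRatHom.exists_linearForm_malcevLog (hh : IsRatHom h)
    (hc : 1 ≤ Group.nilpotencyClass N) :
    ∃ φ : TruncGroupAlgebra N →ₗ[ℚ] ℚ, ∀ x, φ (malcevLog N x) = h x := by
  let Ψ : TruncGroupAlgebra N →ₐ[ℚ] DualNumber ℚ :=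
    Ideal.Quotient.liftₐ _ hh.dualNumberHom fun a ha => hh.dualNumberHom_eq_zero (by omega) ha
  refine ⟨(TrivSqZeroExt.sndHom ℚ ℚ).comp Ψ.toLinearMap, fun x => ?_⟩
  have hx : Ψ (toTruncGroupAlgebra N x - 1) = TrivSqZeroExt.inr (h x) := by
    have : Ψ (toTruncGroupAlgebra N x) = 1 + TrivSqZeroExt.inr (h x) := hh.dualNumberHom_of x
    rw [map_sub, this, _root_.map_one, add_sub_cancel_left]
  have hlog : Ψ (malcevLog N x) = TrivSqZeroExt.inr (h x) := by
    rw [malcevLog, map_sum, Finset.sum_eq_single_of_mem 1 (Finset.mem_Icc.mpr ⟨le_rfl, hc⟩)]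
    · simp [hx]
    · intro k hk hk1
      obtain ⟨m, rfl⟩ : ∃ m, k = 2 + m := ⟨k - 2, by have := Finset.mem_Icc.mp hk; omega⟩
      rw [map_smul, _root_.map_pow, hx, pow_add (TrivSqZeroExt.inr (h x)), pow_two,
        TrivSqZeroExt.inr_mul_inr, zero_mul, smul_zero]
  change (Ψ (malcevLog N x)).snd = h x
  rw [hlog, TrivSqZeroExt.snd_inr]

/-- The `π`-like condition on the Lie algebra, seen on its largest abelian quotient, which is dual
to the space of homomorphisms to `ℚ`. -/
theorem IsPiLike.exists_monic_aeval_compOp [Group.IsNilpotent N] [HasFiniteRank N] {π : Set ℕ}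
    {σ : N →* N} (hσ : IsPiLike π (malcevLieMap σ).toLinearMap) :
    ∃ f : (PiInt π)[X], f.Monic ∧ ∀ h : N → ℚ, IsRatHom h → aeval (compOp σ) f h = 0 := by
  obtain ⟨f, hf, hfχ⟩ := hσ.exists_lift
  refine ⟨f, hf, fun h hh => ?_⟩
  rcases Nat.eq_zero_or_pos (Group.nilpotencyClass N) with hc | hc
  · have := Group.nilpotencyClass_zero_iff_subsingleton.mp hc
    funext x
    rw [Subsingleton.elim x 1, (hh.aeval_compOp σ f).map_one, Pi.zero_apply]
  obtain ⟨φ, hφ⟩ := hh.exists_linearForm_malcevLog hc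
  let l : N → malcevLieAlgebra N := fun x => ⟨malcevLog N x, LieSubalgebra.subset_lieSpan ⟨x, rfl⟩⟩
  have hl : ∀ x, (malcevLieMap σ).toLinearMap (l x) = l (σ x) := fun x =>
    Subtype.ext (truncMap_malcevLog σ x)
  have h0 : aeval (malcevLieMap σ).toLinearMap f = 0 := by
    have := LinearMap.aeval_self_charpoly (malcevLieMap σ).toLinearMap
    rwa [← hfχ, aeval_map_algebraMap] at this
  funext x
  have := apply_aeval_eq_aeval_compOp (malcevLieMap σ).toLinearMap
    (φ.comp (malcevLieAlgebra N).toSubmodule.subtype) hl f x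
  rw [h0, LinearMap.zero_apply, map_zero] at this
  rw [Pi.zero_apply, this]
  have e : (fun x => (φ.comp (malcevLieAlgebra N).toSubmodule.subtype) (l x)) = h := funext hφ
  rw [e]

end DualNumbers

/-! ### Descent along the lower central series -/

section LowerCentral

open Subgroup

/-- The restriction of an endomorphism to a subgroup that it preserves. -/
def endRestrict {G : Type*} [Group G] (σ : G →* G) (H : Subgroup G) (hH : ∀ x ∈ H, σ x ∈ H) :
    H →* H := (σ.comp H.subtype).codRestrict H fun x => hH x x.2

variable {π : Set ℕ} {N : Type*} [Group N]

theorem map_mem_lowerCentralSeries (σ : N →* N) (k : ℕ) (x : N)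
    (hx : x ∈ (⊤ : Subgroup N).lowerCentralSeries k) :
    σ x ∈ (⊤ : Subgroup N).lowerCentralSeries k :=
  lowerCentralSeries_mono k le_top (map_lowerCentralSeries ⊤ σ k ▸ mem_map_of_mem σ hx)

theorem commutatorElement_mem_lowerCentralSeries {k : ℕ} {x : N}
    (hx : x ∈ (⊤ : Subgroup N).lowerCentralSeries k) (y : N) :
    ⁅x, y⁆ ∈ (⊤ : Subgroup N).lowerCentralSeries (k + 1) :=
  commutator_mem_commutator hx (mem_top y)

/-- The commutator map `γ_k × N → γ_(k + 1)`. -/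
def lowerCentralCommutator (k : ℕ)
    (p : (⊤ : Subgroup N).lowerCentralSeries k × N) :
    (⊤ : Subgroup N).lowerCentralSeries (k + 1) :=
  ⟨⁅(p.1 : N), p.2⁆, commutatorElement_mem_lowerCentralSeries p.1.2 p.2⟩

section Bilinear

variable {k : ℕ} {h : (⊤ : Subgroup N).lowerCentralSeries (k + 1) → ℚ} (hh : IsRatHom h)
  (hk : ∀ x : (⊤ : Subgroup N).lowerCentralSeries (k + 1),
    (x : N) ∈ (⊤ : Subgroup N).lowerCentralSeries (k + 2) → h x = 0)

include hh hk

theorem IsRatHom.eq_of_conj (g : N) (x y : (⊤ : Subgroup N).lowerCentralSeries (k + 1))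
    (hxy : (y : N) = g * x * g⁻¹) : h y = h x := by
  have h1 : ((y * x⁻¹ : (⊤ : Subgroup N).lowerCentralSeries (k + 1)) : N) ∈
      (⊤ : Subgroup N).lowerCentralSeries (k + 2) := by
    have := inv_mem (commutatorElement_mem_lowerCentralSeries x.2 g)
    rw [commutatorElement_inv, commutatorElement_def, ← hxy] at this
    exact this
  have := hk _ h1
  rw [hh, hh.map_inv] at this
  linarith

theorem IsRatHom.commutator_left (y : N) :
    IsRatHom fun x : (⊤ : Subgroup N).lowerCentralSeries k =>
      h (lowerCentralCommutator k (x, y)) := by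
  intro x x'
  have e : lowerCentralCommutator k (x * x', y) =
      ⟨x * ⁅(x' : N), y⁆ * (x : N)⁻¹, by
        have := mul_mem (lowerCentralCommutator k (x * x', y)).2
          (inv_mem (lowerCentralCommutator k (x, y)).2)
        simp only [lowerCentralCommutator, Subgroup.coe_mul,
          commutatorElement_mul_left_eq_conj_mul, mul_inv_cancel_right] at this
        exact this⟩ * lowerCentralCommutator k (x, y) :=
    Subtype.ext (commutatorElement_mul_left_eq_conj_mul (x : N) x' y)
  beta_reduce
  rw [e, hh, add_comm]
  congr 1
  exact hh.eq_of_conj hk x _ _ rfl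

theorem IsRatHom.commutator_right (x : (⊤ : Subgroup N).lowerCentralSeries k) :
    IsRatHom fun y : N => h (lowerCentralCommutator k (x, y)) := by
  intro y y'
  have e : lowerCentralCommutator k (x, y * y') =
      lowerCentralCommutator k (x, y) * ⟨y * ⁅(x : N), y'⁆ * y⁻¹, by
        have := mul_mem (inv_mem (lowerCentralCommutator k (x, y)).2)
          (lowerCentralCommutator k (x, y * y')).2
        simp only [lowerCentralCommutator, commutatorElement_mul_right_eq_mul_conj, mul_assoc,
          inv_mul_cancel_left] at this
        simpa only [mul_assoc] using this⟩ :=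
    Subtype.ext (by
      rw [Subgroup.coe_mul]
      simp only [lowerCentralCommutator, commutatorElement_mul_right_eq_mul_conj, mul_assoc])
  beta_reduce
  rw [e, hh]
  congr 1
  exact hh.eq_of_conj hk y _ _ rfl

end Bilinear

/-- Integrality of `σ` on the abelianization of `N` passes to every factor `γ_k / γ_(k + 1)`, a
quotient of a tensor power of the abelianization: a homomorphism `h` from `γ_(k + 1)` gives the
bilinear map `h ⁅x, y⁆`, on which `σ` acts as the product of its actions on the two variables. -/
theorem exists_monic_aeval_compOp_lowerCentralSeries {σ : N →* N} {f : (PiInt π)[X]}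
    (hf : f.Monic) (hσ : ∀ h : N → ℚ, IsRatHom h → aeval (compOp σ) f h = 0) (k : ℕ) :
    ∃ g : (PiInt π)[X], g.Monic ∧ ∀ h : (⊤ : Subgroup N).lowerCentralSeries k → ℚ, IsRatHom h →
      (∀ x : (⊤ : Subgroup N).lowerCentralSeries k,
        (x : N) ∈ (⊤ : Subgroup N).lowerCentralSeries (k + 1) → h x = 0) →
      aeval (compOp (endRestrict σ _ (map_mem_lowerCentralSeries σ k))) g h = 0 := by
  induction k with
  | zero =>
    refine ⟨f, hf, fun h hh _ => funext fun x => ?_⟩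
    let φ : N → (⊤ : Subgroup N).lowerCentralSeries 0 := fun x => ⟨x, mem_top x⟩
    have h1 := hσ (fun x => h (φ x)) (fun x y => hh (φ x) (φ y))
    have h2 := aeval_compOp_comp (s := σ)
      (t := endRestrict σ _ (map_mem_lowerCentralSeries σ 0)) (φ := φ) (fun _ => rfl) f h x
    rw [h1] at h2
    exact h2.symm
  | succ k ih =>
    obtain ⟨g, hg, ih⟩ := ih
    let σk := endRestrict σ _ (map_mem_lowerCentralSeries σ k)
    let σk' := endRestrict σ _ (map_mem_lowerCentralSeries σ (k + 1))
    let s : (⊤ : Subgroup N).lowerCentralSeries k × N → (⊤ : Subgroup N).lowerCentralSeries k × N :=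
      Prod.map σk id
    let t : (⊤ : Subgroup N).lowerCentralSeries k × N → (⊤ : Subgroup N).lowerCentralSeries k × N :=
      Prod.map id σ
    have hst : Commute (compOp s) (compOp t) := LinearMap.ext fun b => rfl
    obtain ⟨F, hF, a, b, hab⟩ := hst.exists_monic_aeval_mul hg hf
    refine ⟨F, hF, fun h hh hk => ?_⟩
    let β : (⊤ : Subgroup N).lowerCentralSeries k × N → ℚ := fun p => h (lowerCentralCommutator k p)
    have hs : aeval (compOp s) g β = 0 := by
      funext ⟨x, y⟩
      have h1 := ih (fun x => β (x, y)) (hh.commutator_left hk y) fun x hx =>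
        hk _ (commutatorElement_mem_lowerCentralSeries hx y)
      have h2 := aeval_compOp_comp (s := σk) (t := s) (φ := fun x => (x, y)) (fun _ => rfl) g β x
      rw [h1] at h2
      exact h2.symm
    have ht : aeval (compOp t) f β = 0 := by
      funext ⟨x, y⟩
      have h1 := hσ (fun y => β (x, y)) (hh.commutator_right hk x)
      have h2 := aeval_compOp_comp (s := σ) (t := t) (φ := fun y => (x, y)) (fun _ => rfl) f β y
      rw [h1] at h2
      exact h2.symm
    have hF0 : aeval (compOp (Prod.map σk σ)) F β = 0 := by
      have e : compOp (Prod.map σk σ) = compOp s * compOp t := rfl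
      rw [e, hab, LinearMap.add_apply, Module.End.mul_apply, Module.End.mul_apply, hs, ht, map_zero,
        map_zero, add_zero]
    have hcomm : ∀ p, aeval (compOp σk') F h (lowerCentralCommutator k p) = 0 := by
      intro p
      rw [← aeval_compOp_comp (s := Prod.map σk σ)]
      · exact congrFun hF0 p
      · exact fun p => Subtype.ext (map_commutatorElement σ (p.1 : N) p.2).symm
    have hh' := hh.aeval_compOp σk' F
    have hall : ∀ x ∈ (⊤ : Subgroup N).lowerCentralSeries (k + 1),
        ∃ hx, aeval (compOp σk') F h ⟨x, hx⟩ = 0 := by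
      intro x hx
      rw [Subgroup.mem_lowerCentralSeries_succ_iff] at hx
      induction hx using closure_induction with
      | mem x hx =>
        obtain ⟨p, hp, q, -, rfl⟩ := hx
        exact ⟨_, hcomm (⟨p, hp⟩, q)⟩
      | one => exact ⟨one_mem _, hh'.map_one⟩
      | mul x y _ _ hx hy =>
        obtain ⟨hx, ex⟩ := hx
        obtain ⟨hy, ey⟩ := hy
        refine ⟨mul_mem hx hy, ?_⟩
        have := hh' ⟨x, hx⟩ ⟨y, hy⟩
        rwa [ex, ey, add_zero] at this
      | inv x _ hx =>
        obtain ⟨hx, ex⟩ := hx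
        refine ⟨inv_mem hx, ?_⟩
        have := hh'.map_inv ⟨x, hx⟩
        rwa [ex, neg_zero] at this
    funext x
    exact (hall x x.2).2

/-- Homomorphisms to `ℚ` on a subgroup of `γ_k` that kill its intersection with `γ_(k + 1)` extend
to `γ_k`, since `γ_k / γ_(k + 1)` is abelian. -/
theorem IsRatHom.exists_extension_lowerCentralSeries {k : ℕ} {B : Subgroup N} {h : B → ℚ}
    (hh : IsRatHom h) (hB : B ≤ (⊤ : Subgroup N).lowerCentralSeries k)
    (hk : ∀ x : B, (x : N) ∈ (⊤ : Subgroup N).lowerCentralSeries (k + 1) → h x = 0) :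
    ∃ g : (⊤ : Subgroup N).lowerCentralSeries k → ℚ, IsRatHom g ∧
      (∀ x : (⊤ : Subgroup N).lowerCentralSeries k,
        (x : N) ∈ (⊤ : Subgroup N).lowerCentralSeries (k + 1) → g x = 0) ∧
      ∀ x : B, g (inclusion hB x) = h x := by
  let K := (⊤ : Subgroup N).lowerCentralSeries k
  let M : Subgroup K := ((⊤ : Subgroup N).lowerCentralSeries (k + 1)).subgroupOf K
  have hM : M.Normal := inferInstance
  let _ : CommGroup (K ⧸ M) :=
    { mul_comm := fun x y => by
        induction x using QuotientGroup.induction_on with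
        | H x =>
          induction y using QuotientGroup.induction_on with
          | H y =>
            refine QuotientGroup.eq.mpr ?_
            have := commutatorElement_mem_lowerCentralSeries (inv_mem y.2) (x : N)⁻¹
            rw [commutatorElement_def, inv_inv, inv_inv] at this
            rw [mem_subgroupOf]
            simpa [mul_assoc] using this }
  obtain ⟨g, hg⟩ := hh.exists_extension (A := Additive (K ⧸ M))
    (fun x => Additive.ofMul ((inclusion hB x : K) : K ⧸ M)) (fun x y => rfl) (by
      intro x hx
      have hx' : ((inclusion hB x : K) : K ⧸ M) = 1 := hx
      exact hk x (mem_subgroupOf.mp ((QuotientGroup.eq_one_iff (inclusion hB x : K)).mp hx')))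
  refine ⟨fun x => g (Additive.ofMul ((x : K) : K ⧸ M)), fun x y => ?_, fun x hx => ?_, hg⟩
  · beta_reduce
    rw [QuotientGroup.mk_mul, ofMul_mul, map_add]
  · beta_reduce
    rw [(QuotientGroup.eq_one_iff x).mpr (mem_subgroupOf.mpr hx), ofMul_one, map_zero]

/-- Integrality of `σ` on the abelianization of a nilpotent group passes to every invariant
subgroup `A`, through the filtration of `A` by the `A ⊓ γ_k`. -/
theorem exists_monic_aeval_compOp_subgroup [Group.IsNilpotent N] {σ : N →* N} {f : (PiInt π)[X]}
    (hf : f.Monic) (hσ : ∀ h : N → ℚ, IsRatHom h → aeval (compOp σ) f h = 0) (A : Subgroup N)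
    (hA : ∀ x ∈ A, σ x ∈ A) :
    ∃ g : (PiInt π)[X], g.Monic ∧ ∀ h : A → ℚ, IsRatHom h →
      aeval (compOp (endRestrict σ A hA)) g h = 0 := by
  have key : ∀ k : ℕ, ∃ g : (PiInt π)[X], g.Monic ∧ ∀ h : A → ℚ, IsRatHom h →
      (∀ x : A, (x : N) ∈ (⊤ : Subgroup N).lowerCentralSeries k → h x = 0) →
      aeval (compOp (endRestrict σ A hA)) g h = 0 := by
    intro k
    induction k with
    | zero =>
      refine ⟨1, monic_one, fun h _ h0 => ?_⟩
      rw [map_one, Module.End.one_apply]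
      exact funext fun x => h0 x (mem_top _)
    | succ k ih =>
      obtain ⟨F, hF, ih⟩ := ih
      obtain ⟨g, hg, hgk⟩ := exists_monic_aeval_compOp_lowerCentralSeries hf hσ k
      refine ⟨F * g, hF.mul hg, fun h hh hk => ?_⟩
      rw [map_mul, Module.End.mul_apply]
      refine ih _ (hh.aeval_compOp _ _) fun x hx => ?_
      let K := (⊤ : Subgroup N).lowerCentralSeries k
      have hB : ∀ x ∈ A ⊓ K, σ x ∈ A ⊓ K := fun x hx =>
        ⟨hA x hx.1, map_mem_lowerCentralSeries σ k x hx.2⟩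
      obtain ⟨e, he, hek, heA⟩ := IsRatHom.exists_extension_lowerCentralSeries (k := k)
        (B := A ⊓ K) (h := fun x => h (inclusion inf_le_left x))
        (hh.comp (inclusion inf_le_left)) inf_le_right fun x hx => hk _ hx
      have h1 := aeval_compOp_comp (s := endRestrict σ (A ⊓ K) hB) (t := endRestrict σ A hA)
        (φ := inclusion inf_le_left) (fun _ => rfl) g h ⟨x, x.2, hx⟩
      have h2 := aeval_compOp_comp (s := endRestrict σ (A ⊓ K) hB)
        (t := endRestrict σ K (map_mem_lowerCentralSeries σ k))
        (φ := inclusion inf_le_right) (fun _ => rfl) g e ⟨x, x.2, hx⟩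
      rw [hgk e he hek, funext heA] at h2
      exact h1.symm.trans h2
  obtain ⟨c, hc⟩ := Subgroup.nilpotent_iff_lowerCentralSeries.mp ‹Group.IsNilpotent N›
  obtain ⟨g, hg, hgc⟩ := key c
  refine ⟨g, hg, fun h hh => hgc h hh fun x hx => ?_⟩
  rw [hc, mem_bot] at hx
  rw [show x = 1 from Subtype.ext hx, hh.map_one]

end LowerCentral

/-! ### Endomorphisms of abelian groups with an integral inverse -/

section Abelian

variable {π : Set ℕ} {A : Type*} [CommGroup A]

theorem IsPiDivisible.exists_pow_eq {G : Type*} [Group G] (hG : IsPiDivisible π G) (n : ℕ) :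
    n ≠ 0 → IsPiNumber π n → ∀ x : G, ∃ y, y ^ n = x := by
  induction n using induction_on_primes with
  | zero => exact fun h => absurd rfl h
  | one => exact fun _ _ x => ⟨x, pow_one x⟩
  | prime_mul p n hp ih =>
    intro h0 hn x
    push_cast at hn
    obtain ⟨y, rfl⟩ := hG p (hn p hp (dvd_mul_right _ _)) x
    obtain ⟨z, rfl⟩ := ih (right_ne_zero_of_mul h0)
      (fun q hq hqn => hn q hq (hqn.mul_left _)) y
    exact ⟨z, by rw [mul_comm, pow_mul]⟩

theorem IsPiDivisible.exists_isRatHom_eq_mul {G : Type*} [Group G] (hG : IsPiDivisible π G)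
    (r : PiInt π) (x : G) : ∃ y, ∀ h : G → ℚ, IsRatHom h → h y = r * h x := by
  obtain ⟨_, m, n, h0, hn, rfl⟩ := r
  obtain ⟨y, hy⟩ := hG.exists_pow_eq n.natAbs (Int.natAbs_ne_zero.mpr h0)
    (fun p hp hpn => hn p hp (Int.dvd_natAbs.mp hpn)) (x ^ (m * n.sign))
  refine ⟨y, fun h hh => ?_⟩
  have h1 := congrArg h hy
  rw [hh.map_pow, hh.map_zpow] at h1
  have h2 : (n.sign : ℚ) * (n.natAbs : ℚ) = n := by
    rw [← Int.cast_natCast, ← Int.cast_mul, Int.sign_mul_natAbs]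
  have h3 : (n.sign : ℚ) * n.sign = 1 := by
    rcases lt_or_gt_of_ne h0 with h | h
    · simp [Int.sign_eq_neg_one_of_neg h]
    · simp [Int.sign_eq_one_of_pos h]
  have h4 : (n : ℚ) ≠ 0 := by exact_mod_cast h0
  rw [Int.cast_mul] at h1
  have h5 : (n : ℚ) * h y = m * h x := by
    linear_combination (n.sign : ℚ) * h1 - h y * h2 + m * h x * h3
  change h y = m / n * h x
  rw [div_mul_eq_mul_div, eq_div_iff h4, mul_comm, h5]

/-- A `π`-divisible torsion-free abelian group is a module over `ℤ[1/π]`: the element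
`P(τ) a`, recognized by its images under the homomorphisms to `ℚ`, exists in it. -/
theorem IsPiDivisible.exists_eq_aeval_compOp (hA : IsPiDivisible π A) (τ : A →* A)
    (P : (PiInt π)[X]) (a : A) :
    ∃ w : A, ∀ h : A → ℚ, IsRatHom h → h w = aeval (compOp τ) P h a := by
  induction P using Polynomial.induction_on' with
  | add P Q hP hQ =>
    obtain ⟨v, hv⟩ := hP
    obtain ⟨w, hw⟩ := hQ
    exact ⟨v * w, fun h hh => by rw [hh, hv h hh, hw h hh, map_add]; rfl⟩
  | monomial i r =>
    obtain ⟨w, hw⟩ := hA.exists_isRatHom_eq_mul r (τ^[i] a)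
    refine ⟨w, fun h hh => ?_⟩
    rw [hw h hh, aeval_compOp_apply, sum_monomial_index _ _ (by simp)]

theorem aeval_compOp_divX {X' : Type*} (s : X' → X') {G : (PiInt π)[X]} (hG : G.coeff 0 = 1)
    (h : X' → ℚ) (x : X') :
    aeval (compOp s) G h x = aeval (compOp s) G.divX h (s x) + h x := by
  conv_lhs => rw [← divX_mul_X_add G, hG, mul_comm]
  rw [map_add, map_mul, aeval_X, map_one, map_one, LinearMap.add_apply, Module.End.mul_apply]
  rfl

/-- An endomorphism of a torsion-free `π`-divisible abelian group satisfying a polynomial over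
`ℤ[1/π]` with constant coefficient `1` has an inverse, which is a polynomial in it. -/
theorem bijective_of_aeval_compOp_eq_zero (hA : NoTorsion A) (hdiv : IsPiDivisible π A)
    (τ : A →* A) {G : (PiInt π)[X]} (hG : G.coeff 0 = 1)
    (h0 : ∀ h : A → ℚ, IsRatHom h → aeval (compOp τ) G h = 0) : Function.Bijective τ := by
  constructor
  · refine (injective_iff_map_eq_one τ).mpr fun a ha => hA.eq_of_forall_isRatHom fun h hh => ?_
    have := aeval_compOp_divX τ hG h a
    rw [h0 h hh, ha, (hh.aeval_compOp τ _).map_one] at this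
    rw [hh.map_one]
    simpa using this.symm
  · intro a
    obtain ⟨w, hw⟩ := hdiv.exists_eq_aeval_compOp τ (-G.divX) a
    refine ⟨w, hA.eq_of_forall_isRatHom fun h hh => ?_⟩
    rw [hw (fun x => h (τ x)) (hh.comp τ), aeval_compOp_comp (fun _ => rfl), map_neg,
      LinearMap.neg_apply, Pi.neg_apply]
    have := aeval_compOp_divX τ hG h a
    rw [h0 h hh, Pi.zero_apply] at this
    linarith

/-- By the Cayley-Hamilton theorem, an integral endomorphism whose determinant is a unit has an
integral inverse. -/
theorem exists_coeff_zero_eq_one_of_isPiUnit [HasFiniteRank A] {τ : A →* A} {f : (PiInt π)[X]}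
    (hf : f.Monic) (hτ : ∀ h : A → ℚ, IsRatHom h → aeval (compOp τ) f h = 0)
    (hdet : IsPiUnit π (rationalDet τ)) :
    ∃ G : (PiInt π)[X], G.coeff 0 = 1 ∧ ∀ h : A → ℚ, IsRatHom h → aeval (compOp τ) G h = 0 := by
  let ν : Module.End ℚ (ℚ ⊗[ℤ] Additive A) := τ.toAdditive.toIntLinearMap.baseChange ℚ
  let l : A → ℚ ⊗[ℤ] Additive A := fun a => 1 ⊗ₜ Additive.ofMul a
  have hl : ∀ a, ν (l a) = l (τ a) := fun a => by simp [ν, l]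
  have hν : aeval ν f = 0 := by
    refine LinearMap.ext_on span_one_tmul_eq_top ?_
    rintro _ ⟨a, rfl⟩
    rw [LinearMap.zero_apply, ← Module.forall_dual_apply_eq_zero_iff ℚ]
    intro φ
    have := apply_aeval_eq_aeval_compOp ν φ hl f a
    rw [hτ _ (isRatHom_tmul φ)] at this
    exact this
  obtain ⟨χ, -, hχ⟩ := (isPiLike_of_aeval_eq_zero hf hν).exists_lift
  have hχ0 : aeval ν χ = 0 := by
    have := LinearMap.aeval_self_charpoly ν
    rwa [← hχ, aeval_map_algebraMap] at this
  obtain ⟨u, hu⟩ := hdet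
  have hcoeff : (u : PiInt π) = (-1) ^ Module.finrank ℚ (ℚ ⊗[ℤ] Additive A) * χ.coeff 0 := by
    refine Subtype.ext ?_
    have h1 := LinearMap.det_eq_sign_charpoly_coeff ν
    rw [← hχ, coeff_map] at h1
    rw [hu]
    refine h1.trans ?_
    simp
    rfl
  refine ⟨C ((↑u⁻¹ : PiInt π) * (-1) ^ Module.finrank ℚ (ℚ ⊗[ℤ] Additive A)) * χ, ?_, ?_⟩
  · rw [coeff_C_mul, mul_assoc, ← hcoeff, Units.inv_mul]
  · intro h hh
    obtain ⟨φ, hφ⟩ := hh.exists_tensor_lift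
    have h1 : aeval (compOp τ) χ h = 0 := by
      funext a
      have := apply_aeval_eq_aeval_compOp ν φ hl χ a
      have e : (fun x => φ (l x)) = h := funext hφ
      rw [e] at this
      refine this.symm.trans ?_
      have e0 : φ (aeval ν χ (l a)) = 0 := by rw [hχ0, LinearMap.zero_apply, map_zero]
      exact e0
    rw [map_mul, Module.End.mul_apply, h1, map_zero]

end Abelian

/-! ### Ascent along the upper central series -/

section UpperCentral

open Subgroup

variable {π : Set ℕ} {N : Type*} [Group N]

/-- The commutator map `Z_2 × N → Z_1`, where `Z_2` is the second centre, the preimage of the centre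
of `N ⧸ Z_1`. -/
def secondCenterCommutator (p : (center (N ⧸ center N)).comap (QuotientGroup.mk' (center N)) × N) :
    center N :=
  ⟨⁅(p.1 : N), p.2⁆, mk_mem_center_quotient_iff.mp p.1.2 p.2⟩

theorem secondCenterCommutator_mul_left
    (u v : (center (N ⧸ center N)).comap (QuotientGroup.mk' (center N))) (y : N) :
    secondCenterCommutator (u * v, y) =
      secondCenterCommutator (v, y) * secondCenterCommutator (u, y) := by
  refine Subtype.ext ?_
  rw [Subgroup.coe_mul]
  change ⁅(u : N) * v, y⁆ = ⁅(v : N), y⁆ * ⁅(u : N), y⁆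
  have hv : (u : N) * ⁅(v : N), y⁆ = ⁅(v : N), y⁆ * u :=
    mem_center_iff.mp (secondCenterCommutator (v, y)).2 u
  rw [commutatorElement_mul_left_eq_conj_mul, hv, mul_inv_cancel_right]

theorem secondCenterCommutator_mul_right
    (u : (center (N ⧸ center N)).comap (QuotientGroup.mk' (center N))) (y z : N) :
    secondCenterCommutator (u, y * z) =
      secondCenterCommutator (u, y) * secondCenterCommutator (u, z) := by
  refine Subtype.ext ?_
  rw [Subgroup.coe_mul]
  change ⁅(u : N), y * z⁆ = ⁅(u : N), y⁆ * ⁅(u : N), z⁆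
  have hz : y * ⁅(u : N), z⁆ = ⁅(u : N), z⁆ * y :=
    mem_center_iff.mp (secondCenterCommutator (u, z)).2 y
  rw [commutatorElement_mul_right_eq_mul_conj, mul_assoc ⁅(u : N), y⁆, hz, mul_assoc,
    mul_inv_cancel_right]

open scoped IsMulCommutative in
/-- If `σ` is integral on the abelianization of `N` and has an integral inverse on the centre `Z_1`,
then it has an integral inverse on `Z_2 / Z_1`. On the forms `φ ⁅u, y⁆` on `Z_2 × N`, with `φ` a
homomorphism from `Z_1` to `ℚ`, the action of `σ` on both variables has an integral inverse and the
action on `y` is integral; hence the action on `u` has an integral inverse. As these forms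
separate the elements of `Z_2 / Z_1`, every homomorphism from `Z_2 / Z_1` to `ℚ` comes from them. -/
theorem exists_coeff_zero_eq_one_quotient_center (hN : NoTorsion N) {σ : N →* N}
    (hZ : ∀ z ∈ center N, σ z ∈ center N)
    (hU : ∀ u ∈ center (N ⧸ center N), QuotientGroup.map _ _ σ hZ u ∈ center (N ⧸ center N))
    {f G : (PiInt π)[X]} (hf : f.Monic)
    (hσ : ∀ h : N → ℚ, IsRatHom h → aeval (compOp σ) f h = 0) (hG : G.coeff 0 = 1)
    (hσZ : ∀ h : center N → ℚ, IsRatHom h → aeval (compOp (endRestrict σ _ hZ)) G h = 0) :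
    ∃ H : (PiInt π)[X], H.coeff 0 = 1 ∧ ∀ h : center (N ⧸ center N) → ℚ, IsRatHom h →
      aeval (compOp (endRestrict (QuotientGroup.map _ _ σ hZ) _ hU)) H h = 0 := by
  let W : Subgroup N := (center (N ⧸ center N)).comap (QuotientGroup.mk' (center N))
  let σW : W →* W := endRestrict σ W fun u hu => hU _ hu
  let s : W × N → W × N := Prod.map σW id
  let t : W × N → W × N := Prod.map id σ
  have hst : Commute (compOp s) (compOp t) := LinearMap.ext fun b => rfl
  obtain ⟨H, hH, a, b, hab⟩ := hst.exists_coeff_zero_eq_one_aeval hf hG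
  refine ⟨H, hH, fun h hh => ?_⟩
  have hβ : ∀ φ : center N → ℚ, IsRatHom φ →
      aeval (compOp s) H (fun p => φ (secondCenterCommutator p)) = 0 := by
    intro φ hφ
    have ht : aeval (compOp t) f (fun p => φ (secondCenterCommutator p)) = 0 := by
      funext ⟨u, y⟩
      have h1 := hσ (fun y => φ (secondCenterCommutator (u, y))) fun y z => by
        beta_reduce
        rw [secondCenterCommutator_mul_right, hφ]
      have h2 := aeval_compOp_comp (s := σ) (t := t) (φ := fun y => (u, y)) (fun _ => rfl) f
        (fun p => φ (secondCenterCommutator p)) y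
      rw [h1] at h2
      exact h2.symm
    have hd : aeval (compOp s * compOp t) G (fun p => φ (secondCenterCommutator p)) = 0 := by
      have e : compOp s * compOp t = compOp (Prod.map σW σ) := rfl
      rw [e]
      funext p
      rw [aeval_compOp_comp (t := endRestrict σ _ hZ), hσZ φ hφ]
      · rfl
      · exact fun p => Subtype.ext (map_commutatorElement σ (p.1 : N) p.2).symm
    rw [hab, LinearMap.add_apply, Module.End.mul_apply, Module.End.mul_apply, ht, hd, map_zero,
      map_zero, add_zero]
  let j : W →* center (N ⧸ center N) :=
    ((QuotientGroup.mk' (center N)).comp W.subtype).codRestrict _ fun u => u.2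
  let Θ : W → ({φ : center N → ℚ // IsRatHom φ} × N → ℚ) := fun u q =>
    q.1.1 (secondCenterCommutator (u, q.2))
  obtain ⟨k, hk⟩ := (hh.comp j).exists_extension Θ
    (fun u v => funext fun q => by
      change q.1.1 (secondCenterCommutator (u * v, q.2)) = _
      rw [secondCenterCommutator_mul_left, q.1.2, add_comm]
      rfl)
    (fun u hu => by
      have h1 : (u : N) ∈ center N := by
        rw [mem_center_iff_commutatorElement]
        intro y
        have h2 : secondCenterCommutator (u, y) = 1 :=
          (hN.subgroup (center N)).eq_of_forall_isRatHom fun φ hφ => by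
            rw [hφ.map_one]
            exact congrFun hu (⟨φ, hφ⟩, y)
        exact congrArg Subtype.val h2
      have h3 : j u = 1 := Subtype.ext ((QuotientGroup.eq_one_iff (u : N)).mpr h1)
      rw [h3, hh.map_one])
  funext ⟨u, hu⟩
  obtain ⟨x, rfl⟩ := QuotientGroup.mk_surjective u
  have h1 := aeval_compOp_comp (s := σW) (t := endRestrict (QuotientGroup.map _ _ σ hZ) _ hU)
    (φ := j) (fun _ => rfl) H h ⟨x, hu⟩
  refine h1.symm.trans ?_
  have h2 : ∑ i ∈ H.support, ((H.coeff i : PiInt π) : ℚ) • Θ (σW^[i] ⟨x, hu⟩) = 0 := by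
    funext q
    have h3 := congrFun (hβ q.1.1 q.1.2) (⟨x, hu⟩, q.2)
    rw [aeval_compOp_apply, Polynomial.sum] at h3
    simp only [s, Prod.map_iterate, Function.iterate_id] at h3
    rw [Finset.sum_apply]
    exact h3
  have h4 := congrArg k.toRatLinearMap h2
  rw [map_zero, map_sum] at h4
  rw [aeval_compOp_apply, Polynomial.sum, Pi.zero_apply, ← h4]
  refine Finset.sum_congr rfl fun i _ => ?_
  rw [map_smul, smul_eq_mul, ← hk]
  rfl

open scoped IsMulCommutative in
/-- The conclusion under hypotheses that `N ⧸ Z(N)` inherits; unlike injectivity and finite rank,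
which give it, the existence of powers in the image passes to quotients at once. -/
theorem bijective_of_integral_inverse_center [Group.IsNilpotent N]
    (hπ : ∀ p ∈ π, p.Prime) : NoTorsion N →
    IsPiDivisible π N → ∀ σ : N →* N, (∀ y, ∃ n : ℕ, 0 < n ∧ ∃ x, σ x = y ^ n) →
    ∀ hZ : ∀ z ∈ center N, σ z ∈ center N,
    (∃ f : (PiInt π)[X], f.Monic ∧ ∀ h : N → ℚ, IsRatHom h → aeval (compOp σ) f h = 0) →
    (∃ G : (PiInt π)[X], G.coeff 0 = 1 ∧ ∀ h : center N → ℚ, IsRatHom h →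
      aeval (compOp (endRestrict σ _ hZ)) G h = 0) →
    Function.Bijective σ := by
  refine Group.nilpotent_center_quotient_ind (P := fun N _ _ => NoTorsion N →
    IsPiDivisible π N → ∀ σ : N →* N, (∀ y, ∃ n : ℕ, 0 < n ∧ ∃ x, σ x = y ^ n) →
    ∀ hZ : ∀ z ∈ center N, σ z ∈ center N,
    (∃ f : (PiInt π)[X], f.Monic ∧ ∀ h : N → ℚ, IsRatHom h → aeval (compOp σ) f h = 0) →
    (∃ G : (PiInt π)[X], G.coeff 0 = 1 ∧ ∀ h : center N → ℚ, IsRatHom h →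
      aeval (compOp (endRestrict σ _ hZ)) G h = 0) →
    Function.Bijective σ) N ?_ ?_
  · intro N _ _ _ _ σ _ _ _ _
    exact ⟨Function.injective_of_subsingleton _, fun y => ⟨1, Subsingleton.elim _ _⟩⟩
  · rintro N _ _ ih hN hdiv σ hpow hZ ⟨f, hf, hσ⟩ ⟨G, hG, hσZ⟩
    have hbar : Function.Bijective (QuotientGroup.map (center N) (center N) σ hZ) := by
      have hpow' : ∀ y : N ⧸ center N, ∃ n : ℕ, 0 < n ∧
          ∃ x, QuotientGroup.map (center N) (center N) σ hZ x = y ^ n := by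
        intro y
        obtain ⟨y, rfl⟩ := QuotientGroup.mk_surjective y
        obtain ⟨n, hn, x, hx⟩ := hpow y
        exact ⟨n, hn, x, congrArg (QuotientGroup.mk' (center N)) hx⟩
      have hU : ∀ u ∈ center (N ⧸ center N),
          QuotientGroup.map (center N) (center N) σ hZ u ∈ center (N ⧸ center N) := fun u hu =>
        hN.quotient_center.map_mem_center hpow' hu
      refine ih hN.quotient_center (fun p hp x => ?_) _ hpow' hU ⟨f, hf, fun h hh => ?_⟩
        (exists_coeff_zero_eq_one_quotient_center hN hZ hU hf hσ hG hσZ)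
      · obtain ⟨x, rfl⟩ := QuotientGroup.mk_surjective x
        obtain ⟨y, rfl⟩ := hdiv p hp x
        exact ⟨y, rfl⟩
      · funext x
        obtain ⟨x, rfl⟩ := QuotientGroup.mk_surjective x
        have h1 := hσ _ (hh.comp (QuotientGroup.mk' (center N)))
        have h2 := aeval_compOp_comp (s := σ) (t := QuotientGroup.map (center N) (center N) σ hZ)
          (φ := QuotientGroup.mk' (center N)) (fun _ => rfl) f h x
        rw [h1] at h2
        exact h2.symm
    have hcen : Function.Bijective (endRestrict σ _ hZ) := by
      refine bijective_of_aeval_compOp_eq_zero (π := π) (hN.subgroup _) (fun p hp z => ?_) _ hG hσZ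
      obtain ⟨y, hy⟩ := hdiv p hp z
      exact ⟨⟨y, hN.mem_center_of_pow_mem (hπ p hp).pos (by rw [hy]; exact z.2)⟩, Subtype.ext hy⟩
    constructor
    · refine (injective_iff_map_eq_one σ).mpr fun x hx => ?_
      have hxZ : x ∈ center N := by
        rw [← QuotientGroup.eq_one_iff]
        exact (injective_iff_map_eq_one _).mp hbar.1 _
          (congrArg (QuotientGroup.mk' (center N)) hx)
      exact congrArg Subtype.val
        ((injective_iff_map_eq_one _).mp hcen.1 ⟨x, hxZ⟩ (Subtype.ext hx))
    · intro y
      obtain ⟨x, hx⟩ := hbar.2 y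
      obtain ⟨x, rfl⟩ := QuotientGroup.mk_surjective x
      obtain ⟨z, hz⟩ := hcen.2 ⟨_, QuotientGroup.eq.mp hx⟩
      have hz' : σ z = (σ x)⁻¹ * y := congrArg Subtype.val hz
      exact ⟨x * z, by rw [map_mul, hz', mul_inv_cancel_left]⟩

end UpperCentral

/-! ### Endomorphisms whose determinant on the centre is a unit -/

theorem theorem3p6 (π : Set ℕ) (hπ : ∀ p ∈ π, p.Prime)
    {N : Type*} [Group N] [Group.IsNilpotent N] [HasFiniteRank N]
    (htf : ∀ x : N, IsOfFinOrder x → x = 1) (hdiv : IsPiDivisible π N)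
    (σ : N →* N) (hσ : IsPiLikeEnd π σ) :
    ∃ hZ : ∀ z ∈ Subgroup.center N, σ z ∈ Subgroup.center N,
      IsPiUnit π (centerDet σ hZ) → Function.Bijective σ := by
  have hN : NoTorsion N := noTorsion_iff.mpr htf
  have hpow := hN.exists_pow_mem_range hσ.1
  have hZ : ∀ z ∈ Subgroup.center N, σ z ∈ Subgroup.center N := fun z hz =>
    hN.map_mem_center hpow hz
  refine ⟨hZ, fun hdet => ?_⟩
  obtain ⟨f, hf, hσf⟩ := hσ.2.exists_monic_aeval_compOp
  obtain ⟨g, hg, hσg⟩ := exists_monic_aeval_compOp_subgroup hf hσf (Subgroup.center N) hZ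
  have : HasFiniteRank (Subgroup.center N) := HasFiniteRank.subgroup _
  open scoped IsMulCommutative in
  exact bijective_of_integral_inverse_center hπ hN hdiv σ hpow hZ ⟨f, hf, hσf⟩
    (exists_coeff_zero_eq_one_of_isPiUnit hg hσg hdet)
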